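/- Let $\alpha,\beta\in\mathbb C$ with $\alpha\neq 0,-1,-2,\ldots$, and let \[ \mathbf M(\alpha,\beta,z)=\frac1{\Gamma(\alpha)}\sum_{k=0}^\infty\frac{\Gamma(k+\alpha)}{\Gamma(k+\beta)\,k!}z^k, \qquad p_n[\mathbf M](z)=\frac1{\Gamma(\alpha)}\sum_{k=0}^n\frac{\Gamma(k+\alpha)}{\Gamma(k+\beta)\,k!}z^k \] (where $1/\Gamma$ is taken to be $0$ at the poles of $\Gamma$) be the entire confluent hypergeometric function and its Maclaurin partial sums. Let \[ S=\{z\in\mathbb C:\ |ze^{1-z}|=1,\ |z|\le1,\ \operatorname{Re}z>0\}. \] (a) The limit points, as $n\to\infty$, of the zeros of $p_{n-1}[\mathbf M](nz)$ in the right half-plane $\operatorname{Re}z>0$ are precisely the points of $S$. (A point $z_0$ is a limit point of the zeros if each of its neighbourhoods contains a zero of $p_{n-1}[\mathbf M](nz)$ for infinitely many $n$.) (b) Let $\xi\in S$, $\xi\neq1$, put $\tau=\operatorname{Im}(\xi-1-\log\xi)$, let $\tau_n\equiv\tau n\pmod{2\pi}$ with $-\pi<\tau_n\le\pi$, and let \[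 z_n(w)=\xi\left(1+\frac{\log n}{2(1-\xi)n}-\frac{w-i\tau_n}{(1-\xi)n}\right). \] Then \[ \lim_{n\to\infty}\frac{p_{n-1}[\mathbf M](nz_n(w))}{\mathbf M(\alpha,\beta,nz_n(w))}=1-\frac{e^{-w}}{\xi^{\alpha-\beta}(1-\xi)\sqrt{2\pi}} \] uniformly on compact subsets of the $w$-plane; here $\log\xi$ and $\xi^{\alpha-\beta}$ are principal values. (c) With $\operatorname{erfc}(z)=\frac2{\sqrt\pi}\int_z^{z+\infty}e^{-s^2}\,ds$, the integral being taken along the horizontal ray to the right from $z$, \[ \lim_{n\to\infty}\frac{p_{n-1}[\mathbf M](n+w\sqrt n)}{\mathbf M(\alpha,\beta,n+w\sqrt n)}=\frac12\operatorname{erfc}\!\left(\frac{w}{\sqrt2}\right) \] uniformly on compact subsets of $\operatorname{Re}w<0$. In (b) and (c), for each compact set of $w$, the denominators are nonzero on it for all sufficiently large $n$. -/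

import Mathlib

open Filter Topology

namespace ConfluentSections

/-- The `k`-th Maclaurin coefficient of `Γ(α) 𝐌(α, β, z)`, namely `Γ(k+α) / (Γ(k+β) k!)`.
If `k + β` is a pole of `Γ` then `1 / Γ(k+β)` is read as `0`, as usual; this is what the
conventions `Complex.Gamma (-m) = 0` and `x / 0 = 0` give. -/
noncomputable def coeff (α β : ℂ) (k : ℕ) : ℂ :=
  Complex.Gamma (k + α) / (Complex.Gamma (k + β) * (k.factorial : ℂ))

/-- The confluent hypergeometric function
`𝐌(α, β, z) = (1 / Γ(α)) ∑_{k ≥ 0} Γ(k+α) / (Γ(k+β) k!) z ^ k`. -/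
noncomputable def M (α β z : ℂ) : ℂ :=
  1 / Complex.Gamma α * ∑' k : ℕ, coeff α β k * z ^ k

/-- The `n`-th partial sum (terms of degree `0, …, n`) of the Maclaurin series of `𝐌(α, β, ·)`. -/
noncomputable def partialSum (α β : ℂ) (n : ℕ) (z : ℂ) : ℂ :=
  1 / Complex.Gamma α * ∑ k ∈ Finset.range (n + 1), coeff α β k * z ^ k

/-- The part of the Szegő curve in the open right half-plane. -/
def szegoCurve : Set ℂ :=
  {z | ‖z * Complex.exp (1 - z)‖ = 1 ∧ ‖z‖ ≤ 1 ∧ 0 < z.re}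

/-- `z₀` is a limit point of the zeros of the sequence of functions `P n`: every neighbourhood
of `z₀` contains zeros of `P n` for infinitely many `n`. -/
def IsLimitPointOfZeros (P : ℕ → ℂ → ℂ) (z₀ : ℂ) : Prop :=
  ∀ ε > 0, ∃ᶠ n in atTop, ∃ z ∈ Metric.ball z₀ ε, P n z = 0

/-- `τ = Im (ξ - 1 - log ξ)`, with the principal logarithm. -/
noncomputable def tau (ξ : ℂ) : ℝ :=
  (ξ - 1 - Complex.log ξ).im

/-- `τ_n`: the representative of `τ n` modulo `2π` in `(-π, π]`. -/
noncomputable def tauSeq (ξ : ℂ) (n : ℕ) : ℝ :=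
  toIocMod Real.two_pi_pos (-Real.pi) (tau ξ * n)

/-- `z_n(w) = ξ (1 + log n / (2 (1 - ξ) n) - (w - i τ_n) / ((1 - ξ) n))`. -/
noncomputable def arcPoint (ξ : ℂ) (n : ℕ) (w : ℂ) : ℂ :=
  ξ * (1 + (Real.log n : ℂ) / (2 * (1 - ξ) * n)
    - (w - Complex.I * (tauSeq ξ n : ℂ)) / ((1 - ξ) * n))

/-- The complementary error function `erfc z = (2 / √π) ∫_z^{z+∞} exp (-s²) ds`, the integral
being along the horizontal ray `s = z + t`, `t > 0`. -/
noncomputable def erfc (z : ℂ) : ℂ :=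
  2 / (Real.sqrt Real.pi : ℂ) * ∫ t in Set.Ioi (0 : ℝ), Complex.exp (-(z + (t : ℂ)) ^ 2)

end ConfluentSections

namespace ConfluentSections

/-! Write the partial sum as the full series minus its tail. For `Re ζ > 0` the series `Γ(α) 𝐌(α, β,
nζ)` is asymptotic to `e^{nζ} (nζ)^{α-β}`, locally uniformly in `ζ` (`hasLeadingAsymptotics`). For
large parameters this is dominated convergence in a beta integral, and contiguous relations carry it
to all parameters. The tail is its first term times `∑ c_j ζ^j`, where `c_0 = 1` and the `c_j` vary
slowly. By Stirling's formula (`tendsto_coeff_scaled`), the ratio of tail to series behaves like `(ζ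
e^{1-ζ})^n / (√(2πn) ζ^{α-β})` times that sum.

For `|ζ| ≤ 1` away from `1` the sum tends to the geometric value `1 / (1 - ζ)`, even on the unit
circle (`tendsto_tsum_of_slowRecurrence`). At distance `log n / n` from a point of the curve, `(ζ
e^{1-ζ})^n / √n` tends to `e^{-w}` (`tendsto_arcPoint_pow`), which gives (b). At `ζ = 1 + w/√n` the
sum divided by `√n` is a Riemann sum for a Gaussian integral (`tendsto_critical_sum`), which is an
`erfc` after completing the square; this gives (c).

For (a), inside the unit disc and off the curve either the series or the tail dominates. For `|ζ| ≥
1`, `ζ` away from `1`, the polynomial read from its top degree down is nearly a geometric series in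
`1/ζ`. So no zeros accumulate off the curve. On the curve, a Hurwitz argument applied to the limit
underlying (b) produces zeros near every point other than `1`, and `1` is a limit of such points. -/

/-! ### Recurrence and decay of the coefficients -/

lemma inv_Gamma_eq (s : ℂ) :
    (Complex.Gamma s)⁻¹ = s * (Complex.Gamma (s + 1))⁻¹ := by
  simpa only [one_div] using Complex.one_div_Gamma_eq_self_mul_one_div_Gamma_add_one s

lemma natCast_add_ne_zero {α : ℂ} (hα : ∀ m : ℕ, α ≠ -(m : ℂ)) (k : ℕ) : (k : ℂ) + α ≠ 0 := by
  intro h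
  exact hα k (by linear_combination h)

lemma Gamma_natCast_add_ne_zero {α : ℂ} (hα : ∀ m : ℕ, α ≠ -(m : ℂ)) (k : ℕ) :
    Complex.Gamma (k + α) ≠ 0 := by
  refine Complex.Gamma_ne_zero fun m h => hα (k + m) ?_
  push_cast
  linear_combination h

lemma coeff_eq (α β : ℂ) (k : ℕ) :
    coeff α β k = Complex.Gamma (k + α) * (Complex.Gamma (k + β))⁻¹ * ((k.factorial : ℂ))⁻¹ := by
  rw [coeff, div_eq_mul_inv, mul_inv, mul_assoc]

/-- The recurrence of the coefficients. -/
lemma coeff_succ {α : ℂ} (β : ℂ) {k : ℕ} (hk : (k : ℂ) + α ≠ 0) :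
    coeff α β (k + 1) * ((k + 1) * (k + β)) = (k + α) * coeff α β k := by
  have h1 : (k : ℂ) + 1 ≠ 0 := by exact_mod_cast Nat.succ_ne_zero k
  rw [coeff_eq, coeff_eq, inv_Gamma_eq (k + β), Nat.factorial_succ]
  push_cast
  rw [show (k : ℂ) + 1 + α = (k + α) + 1 by ring, show (k : ℂ) + 1 + β = (k + β) + 1 by ring,
    Complex.Gamma_add_one _ hk, mul_inv]
  field_simp

lemma eventually_mul_norm_le (c : ℂ) (ε : ℝ) (hε : 0 < ε) :
    ∀ᶠ k : ℕ in atTop, ‖c‖ ≤ ε * k := by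
  obtain ⟨N, hN⟩ := exists_nat_ge (‖c‖ / ε)
  filter_upwards [eventually_ge_atTop N] with k hk
  have : (N : ℝ) ≤ k := by exact_mod_cast hk
  rw [div_le_iff₀ hε] at hN
  nlinarith

lemma eventually_half_le_norm_add (c : ℂ) :
    ∀ᶠ k : ℕ in atTop, (k : ℝ) / 2 ≤ ‖(k : ℂ) + c‖ := by
  filter_upwards [eventually_mul_norm_le c (1 / 2) (by norm_num)] with k hk
  have h := norm_sub_le_norm_add (k : ℂ) c
  rw [Complex.norm_natCast] at h
  linarith

lemma eventually_norm_coeff_succ_le (α β : ℂ) :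
    ∀ᶠ k : ℕ in atTop, ‖coeff α β (k + 1)‖ * (k + 1) ≤ 4 * ‖coeff α β k‖ := by
  filter_upwards [eventually_mul_norm_le α 1 one_pos, eventually_half_le_norm_add β,
    eventually_half_le_norm_add α, eventually_gt_atTop 0] with k h1 h2 h4 h3
  have hk : (0 : ℝ) < k := by exact_mod_cast h3
  have hka : (k : ℂ) + α ≠ 0 := by
    intro h
    rw [h, norm_zero] at h4
    linarith
  have h := congrArg norm (coeff_succ β hka)
  have h5 : ‖(k : ℂ) + α‖ ≤ 2 * k := by
    have := norm_add_le (k : ℂ) α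
    rw [Complex.norm_natCast] at this
    linarith
  have h6 : ‖(k : ℂ) + 1‖ = k + 1 := by
    have := Complex.norm_natCast (k + 1)
    push_cast at this
    exact this
  rw [norm_mul, norm_mul, norm_mul, h6] at h
  have h7 : ‖coeff α β (k + 1)‖ * (k + 1) * (k / 2) ≤ 2 * k * ‖coeff α β k‖ := by
    calc _ ≤ ‖coeff α β (k + 1)‖ * (k + 1) * ‖(k : ℂ) + β‖ := by gcongr
      _ = ‖(k : ℂ) + α‖ * ‖coeff α β k‖ := by rw [← h]; ring
      _ ≤ _ := by gcongr
  have h8 : (k : ℝ) * (‖coeff α β (k + 1)‖ * (k + 1)) ≤ k * (4 * ‖coeff α β k‖) := by linarith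
  exact le_of_mul_le_mul_left h8 hk

lemma summable_coeff_mul_pow (α β z : ℂ) : Summable fun k : ℕ => coeff α β k * z ^ k := by
  -- Consecutive terms have ratio at most `4‖z‖ / (k + 1)`, which is at most `1 / 2` once `‖z‖ ≤ k /
  -- 8`.
  refine summable_of_ratio_norm_eventually_le (r := 1 / 2) (by norm_num) ?_
  filter_upwards [eventually_norm_coeff_succ_le α β,
    eventually_mul_norm_le z (1 / 8) (by norm_num)] with k h1 h2
  rw [norm_mul, norm_mul, norm_pow, norm_pow, pow_succ]
  have h3 : ‖z‖ ≤ (1 / 8) * (k + 1) := by linarith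
  calc ‖coeff α β (k + 1)‖ * (‖z‖ ^ k * ‖z‖) ≤ ‖coeff α β (k + 1)‖ * (‖z‖ ^ k * ((1 / 8) * (k + 1))) := by
        gcongr
    _ = (‖coeff α β (k + 1)‖ * (k + 1)) * (‖z‖ ^ k / 8) := by ring
    _ ≤ (4 * ‖coeff α β k‖) * (‖z‖ ^ k / 8) := by gcongr
    _ = _ := by ring

/-! ### Contiguous relations -/

/-- The power series `Γ(α) 𝐌(α, β, z)`. -/
noncomputable def series (α β z : ℂ) : ℂ := ∑' k : ℕ, coeff α β k * z ^ k

lemma hasSum_series (α β z : ℂ) : HasSum (fun k : ℕ => coeff α β k * z ^ k) (series α β z) :=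
  (summable_coeff_mul_pow α β z).hasSum

/-- Multiplication by `z` shifts coefficients. The explicit zero at index `0` lets the contiguous
relations be checked one power of `z` at a time. -/
lemma hasSum_mul_series (α β z : ℂ) :
    HasSum (fun k : ℕ => (if k = 0 then 0 else coeff α β (k - 1)) * z ^ k)
      (z * series α β z) := by
  rw [← add_zero (z * series α β z)]
  have h := (hasSum_nat_add_iff (f := fun k : ℕ =>
    (if k = 0 then 0 else coeff α β (k - 1)) * z ^ k) (g := z * series α β z) 1).1 ?_
  · simpa using h
  · refine ((hasSum_series α β z).mul_left z).congr_fun fun k => ?_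
    simp only [Nat.add_eq_zero_iff, one_ne_zero, and_false, if_false, Nat.add_sub_cancel, pow_succ]
    ring

/-- A contiguous relation raising `β - α`. -/
lemma series_eq_add_right (α β z : ℂ) :
    series α β z = β * series α (β + 1) z + z * series (α + 1) (β + 2) z := by
  -- Coefficientwise this is `1/Γ(k+β) = (k+β)/Γ(k+β+1)` with `k + β` split into its two summands;
  -- it remains valid at the poles.
  refine (hasSum_series α β z).unique ?_
  refine (((hasSum_series α (β + 1) z).mul_left β).add
    (hasSum_mul_series (α + 1) (β + 2) z)).congr_fun fun k => ?_
  rcases k with _ | k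
  · simp only [coeff_eq, inv_Gamma_eq ((0 : ℕ) + β)]
    simp
    ring
  · have h1 : (k : ℂ) + 1 ≠ 0 := by exact_mod_cast Nat.succ_ne_zero k
    have h2 : ((k.factorial : ℕ) : ℂ) ≠ 0 := by exact_mod_cast Nat.factorial_ne_zero k
    simp only [coeff_eq, inv_Gamma_eq ((k + 1 : ℕ) + β), Nat.add_eq_zero_iff, one_ne_zero,
      and_false, if_false, Nat.add_sub_cancel, Nat.factorial_succ]
    push_cast
    rw [show (k : ℂ) + 1 + (β + 1) = k + 1 + β + 1 by ring,
      show (k : ℂ) + (β + 2) = k + 1 + β + 1 by ring,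
      show (k : ℂ) + (α + 1) = k + 1 + α by ring]
    field_simp
    ring

/-- A contiguous relation raising `α`. -/
lemma mul_series_eq_add {α : ℂ} (hα : ∀ m : ℕ, α ≠ -(m : ℂ)) (β z : ℂ) :
    α * series α β z
      = β * series (α + 1) (β + 1) z + (α - β) * (z * series (α + 1) (β + 2) z) := by
  -- Coefficientwise this is `α (k + β) = β (k + α) + (α - β) k`.
  refine ((hasSum_series α β z).mul_left α).unique ?_
  refine (((hasSum_series (α + 1) (β + 1) z).mul_left β).add
    ((hasSum_mul_series (α + 1) (β + 2) z).mul_left (α - β))).congr_fun fun k => ?_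
  have h0 := natCast_add_ne_zero hα k
  rcases k with _ | k
  · simp only [coeff_eq, inv_Gamma_eq ((0 : ℕ) + β)]
    simp only [Nat.cast_zero, zero_add] at h0 ⊢
    rw [Complex.Gamma_add_one _ h0]
    simp
    ring
  · have h1 : (k : ℂ) + 1 ≠ 0 := by exact_mod_cast Nat.succ_ne_zero k
    have h2 : ((k.factorial : ℕ) : ℂ) ≠ 0 := by exact_mod_cast Nat.factorial_ne_zero k
    simp only [coeff_eq, inv_Gamma_eq ((k + 1 : ℕ) + β), Nat.add_eq_zero_iff, one_ne_zero,
      and_false, if_false, Nat.add_sub_cancel, Nat.factorial_succ]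
    push_cast at h0 ⊢
    rw [show (k : ℂ) + 1 + (β + 1) = k + 1 + β + 1 by ring,
      show (k : ℂ) + (β + 2) = k + 1 + β + 1 by ring,
      show (k : ℂ) + (α + 1) = k + 1 + α by ring,
      show (k : ℂ) + 1 + (α + 1) = k + 1 + α + 1 by ring, Complex.Gamma_add_one _ h0]
    field_simp
    ring

/-! ### Asymptotics of Gamma quotients -/

lemma tendsto_natCast_div_natCast_add (c : ℂ) :
    Tendsto (fun n : ℕ => (n : ℂ) / (n + c)) atTop (𝓝 1) := by
  have h : Tendsto (fun n : ℕ => 1 + c / (n : ℂ)) atTop (𝓝 (1 + 0)) :=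
    tendsto_const_nhds.add (tendsto_const_div_atTop_nhds_zero_nat c)
  have h2 := h.inv₀ (by simp)
  simp only [add_zero, inv_one] at h2
  refine h2.congr' ?_
  filter_upwards [eventually_gt_atTop 0] with n hn
  have : (n : ℂ) ≠ 0 := by exact_mod_cast hn.ne'
  rw [← inv_div _ (n : ℂ), add_div, div_self this]

/-- `Γ(n + 1 + s)` is asymptotic to `n ^ s n!`. -/
lemma tendsto_Gamma_natCast_add_one (s : ℂ) :
    Tendsto (fun n : ℕ => Complex.Gamma (n + 1 + s) / ((n : ℂ) ^ s * n.factorial))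
      atTop (𝓝 1) := by
  -- Away from the poles the quotient is exactly `Γ(s)` divided by Euler's product sequence for
  -- `Γ(s)`.
  have base : ∀ s : ℂ, (∀ m : ℕ, s ≠ -(m : ℂ)) →
      Tendsto (fun n : ℕ => Complex.Gamma (n + 1 + s) / ((n : ℂ) ^ s * n.factorial))
        atTop (𝓝 1) := by
    intro s hs
    have hG : Complex.Gamma s ≠ 0 := Complex.Gamma_ne_zero hs
    have h := ((Complex.GammaSeq_tendsto_Gamma s).inv₀ hG).const_mul (Complex.Gamma s)
    rw [mul_inv_cancel₀ hG] at h
    refine h.congr fun n => ?_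
    have hprod : Complex.Gamma (n + 1 + s)
        = Complex.Gamma s * ∏ j ∈ Finset.range (n + 1), (s + j) := by
      have : ∀ m : ℕ, Complex.Gamma (m + s)
          = Complex.Gamma s * ∏ j ∈ Finset.range m, (s + j) := by
        intro m
        induction m with
        | zero => simp
        | succ m ih =>
          rw [Finset.prod_range_succ, ← mul_assoc, ← ih, mul_comm, add_comm s,
            ← Complex.Gamma_add_one _ (natCast_add_ne_zero hs m)]
          push_cast
          ring_nf
      simpa using this (n + 1)
    rw [hprod, Complex.GammaSeq, inv_div]
    ring
  -- The excluded `s` are reached by passing from `s + 1` to `s`, at the cost of a factor `n / (n +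
  -- 1 + s)` tending to `1`.
  have step : ∀ m : ℕ, ∀ s : ℂ, -(m : ℝ) < s.re →
      Tendsto (fun n : ℕ => Complex.Gamma (n + 1 + s) / ((n : ℂ) ^ s * n.factorial))
        atTop (𝓝 1) := by
    intro m
    induction m with
    | zero =>
      intro s hs
      refine base s fun m h => ?_
      rw [h] at hs
      simp at hs
      linarith [(Nat.cast_nonneg m : (0 : ℝ) ≤ m)]
    | succ m ih =>
      intro s hs
      have h := (ih (s + 1) (by push_cast at hs; simp; linarith)).mul
        (tendsto_natCast_div_natCast_add (1 + s))
      rw [one_mul] at h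
      refine h.congr' ?_
      filter_upwards [eventually_gt_atTop 0, eventually_half_le_norm_add (1 + s)] with n hn h2
      have hn0 : (0 : ℝ) < n := by exact_mod_cast hn
      have hn' : (n : ℂ) ≠ 0 := by exact_mod_cast hn.ne'
      have h3 : (n : ℂ) + (1 + s) ≠ 0 := by
        intro h
        rw [h, norm_zero] at h2
        linarith
      have h4 : (n : ℂ) + 1 + s ≠ 0 := by rwa [add_assoc]
      rw [show (n : ℂ) + 1 + (s + 1) = (n + 1 + s) + 1 by ring, Complex.Gamma_add_one _ h4,
        Complex.cpow_add _ _ hn', Complex.cpow_one, ← add_assoc]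
      have h5 : (n : ℂ) ^ s ≠ 0 := by simp [Complex.cpow_eq_zero_iff, hn']
      have h6 : ((n.factorial : ℕ) : ℂ) ≠ 0 := by exact_mod_cast Nat.factorial_ne_zero n
      field_simp
  obtain ⟨m, hm⟩ := exists_nat_gt (-s.re)
  exact step m s (by linarith)

/-- `Γ(n + α) / Γ(n + β)`, with `1 / Γ` read as `0` at the poles. -/
noncomputable def gammaRatio (α β : ℂ) (n : ℕ) : ℂ :=
  Complex.Gamma (n + α) / Complex.Gamma (n + β)

lemma coeff_eq_gammaRatio_div (α β : ℂ) (n : ℕ) :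
    coeff α β n = gammaRatio α β n / n.factorial := by
  rw [coeff, gammaRatio, div_div]

lemma tendsto_gammaRatio (α β : ℂ) :
    Tendsto (fun n : ℕ => gammaRatio α β n / (n : ℂ) ^ (α - β)) atTop (𝓝 1) := by
  have h := (tendsto_Gamma_natCast_add_one (α - 1)).div
    (tendsto_Gamma_natCast_add_one (β - 1)) one_ne_zero
  rw [div_one] at h
  refine h.congr' ?_
  filter_upwards [eventually_gt_atTop 0] with n hn
  have hn' : (n : ℂ) ≠ 0 := by exact_mod_cast hn.ne'
  have h6 : ((n.factorial : ℕ) : ℂ) ≠ 0 := by exact_mod_cast Nat.factorial_ne_zero n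
  have h5 : ∀ s : ℂ, (n : ℂ) ^ s ≠ 0 := fun s => by simp [Complex.cpow_eq_zero_iff, hn']
  simp only [Pi.div_apply]
  rw [show (n : ℂ) + 1 + (α - 1) = n + α by ring, show (n : ℂ) + 1 + (β - 1) = n + β by ring,
    show α - β = (α - 1) - (β - 1) by ring, Complex.cpow_sub (α - 1) (β - 1) hn',
    gammaRatio]
  have h7 := h5 (α - 1)
  have h8 := h5 (β - 1)
  generalize (n : ℂ) ^ (α - 1) = p at *
  generalize (n : ℂ) ^ (β - 1) = q at *
  field_simp

/-! ### Laplace and beta integrals; leading asymptotics of the series -/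

lemma integrableOn_rpow_mul_exp_neg {s b : ℝ} (hs : -1 < s) (hb : 0 < b) :
    MeasureTheory.IntegrableOn (fun t : ℝ => t ^ s * Real.exp (-(b * t))) (Set.Ioi 0) := by
  simpa using integrableOn_rpow_mul_exp_neg_mul_rpow hs one_pos hb

lemma norm_cpow_mul_exp_neg {t : ℝ} (ht : 0 < t) (a r : ℂ) :
    ‖(t : ℂ) ^ a * Complex.exp (-(r * t))‖ = t ^ a.re * Real.exp (-(r.re * t)) := by
  rw [norm_mul, Complex.norm_cpow_eq_rpow_re_of_pos ht, Complex.norm_exp]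
  simp

lemma integrableOn_cpow_mul_exp_neg {a r : ℂ} (ha : -1 < a.re) (hr : 0 < r.re) :
    MeasureTheory.IntegrableOn (fun t : ℝ => (t : ℂ) ^ a * Complex.exp (-(r * t)))
      (Set.Ioi 0) := by
  refine (integrableOn_rpow_mul_exp_neg ha hr).mono' ?_ ?_
  · exact (by fun_prop : Measurable fun t : ℝ =>
      (t : ℂ) ^ a * Complex.exp (-(r * t))).aestronglyMeasurable
  · filter_upwards [MeasureTheory.ae_restrict_mem measurableSet_Ioi] with t ht
    rw [norm_cpow_mul_exp_neg ht]

/-- The Laplace transform of `t ^ (a - 1)` on the right half-plane. -/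
lemma integral_cpow_mul_exp_neg_mul {a r : ℂ} (ha : 0 < a.re) (hr : 0 < r.re) :
    ∫ t in Set.Ioi (0 : ℝ), (t : ℂ) ^ (a - 1) * Complex.exp (-(r * t))
      = r ^ (-a) * Complex.Gamma a := by
  -- Both sides are analytic in `r` on the right half-plane and agree at the real points `1 +
  -- 1/(n+1)`, which accumulate at `1`; the identity theorem does the rest.
  set U : Set ℂ := {r | 0 < r.re} with hU
  have hUo : IsOpen U := isOpen_lt continuous_const Complex.continuous_re
  have hUc : Convex ℝ U := convex_halfSpace_re_gt 0
  have h1 : AnalyticOnNhd ℂ (fun r : ℂ =>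
      ∫ t in Set.Ioi (0 : ℝ), (t : ℂ) ^ (a - 1) * Complex.exp (-(r * t))) U := by
    refine DifferentiableOn.analyticOnNhd (fun r hr => ?_) hUo
    have hr' : 0 < r.re := hr
    set V : Set ℂ := {s | r.re / 2 < s.re}
    have hV : V ∈ 𝓝 r := (isOpen_lt continuous_const Complex.continuous_re).mem_nhds
      (show r.re / 2 < r.re by linarith)
    have h := hasDerivAt_integral_of_dominated_loc_of_deriv_le (𝕜 := ℂ)
      (μ := MeasureTheory.volume.restrict (Set.Ioi (0 : ℝ))) (x₀ := r) (s := V)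
      (F := fun r t => (t : ℂ) ^ (a - 1) * Complex.exp (-(r * t)))
      (F' := fun r t => (t : ℂ) ^ (a - 1) * (Complex.exp (-(r * t)) * (-t)))
      (bound := fun t => t ^ a.re * Real.exp (-(r.re / 2 * t)))
      hV (Eventually.of_forall fun s => (by fun_prop : Measurable fun t : ℝ =>
        (t : ℂ) ^ (a - 1) * Complex.exp (-(s * t))).aestronglyMeasurable)
      (integrableOn_cpow_mul_exp_neg (by simpa using ha) hr')
      ((by fun_prop : Measurable fun t : ℝ =>
        (t : ℂ) ^ (a - 1) * (Complex.exp (-(r * t)) * (-t))).aestronglyMeasurable)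
      ?_ (integrableOn_rpow_mul_exp_neg (by linarith) (by linarith)) ?_
    · exact h.2.differentiableAt.differentiableWithinAt
    · filter_upwards [MeasureTheory.ae_restrict_mem measurableSet_Ioi] with t ht s hs
      have ht' : (0 : ℝ) < t := ht
      rw [← mul_assoc, norm_mul, norm_cpow_mul_exp_neg ht', norm_neg, Complex.norm_real,
        Real.norm_of_nonneg ht'.le, mul_right_comm]
      have h3 : t ^ (a - 1).re * t = t ^ a.re := by
        rw [← Real.rpow_add_one ht'.ne']
        simp
      rw [h3]
      have hs' : r.re / 2 < s.re := hs
      gcongr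
    · refine Eventually.of_forall fun t s _ => ?_
      refine HasDerivAt.const_mul _ (HasDerivAt.cexp ?_)
      exact (hasDerivAt_mul_const (t : ℂ)).fun_neg
  have h2 : AnalyticOnNhd ℂ (fun r : ℂ => r ^ (-a) * Complex.Gamma a) U := by
    refine DifferentiableOn.analyticOnNhd (fun r hr => ?_) hUo
    have : r ∈ Complex.slitPlane := Or.inl hr
    exact ((differentiableAt_id.cpow_const this).mul_const _).differentiableWithinAt
  have h3 := h1.eqOn_of_preconnected_of_frequently_eq h2 hUc.isPreconnected
    (show (1 : ℂ) ∈ U by simp [hU]) ?_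
  · exact h3 hr
  · have h4 : Tendsto (fun n : ℕ => ((1 + 1 / ((n : ℝ) + 1) : ℝ) : ℂ)) atTop (𝓝[≠] 1) := by
      refine tendsto_nhdsWithin_iff.2 ⟨?_, Eventually.of_forall fun n => ?_⟩
      · have := (Complex.continuous_ofReal.tendsto _).comp
          (tendsto_const_nhds.add (tendsto_one_div_add_atTop_nhds_zero_nat (𝕜 := ℝ)) :
            Tendsto (fun n : ℕ => (1 : ℝ) + 1 / ((n : ℝ) + 1)) atTop (𝓝 (1 + 0)))
        simpa [Function.comp_def] using this
      · have : (0 : ℝ) < 1 / ((n : ℝ) + 1) := by positivity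
        intro h
        have h5 : (1 + 1 / ((n : ℝ) + 1) : ℝ) = 1 :=
          Complex.ofReal_eq_one.1 (Set.mem_singleton_iff.1 h)
        linarith
    refine h4.frequently (Frequently.of_forall fun n => ?_)
    have hn : (0 : ℝ) < 1 + 1 / ((n : ℝ) + 1) := by positivity
    rw [Complex.integral_cpow_mul_exp_neg_mul_Ioi ha hn, one_div, Complex.inv_cpow,
      Complex.cpow_neg]
    rw [Complex.arg_ofReal_of_nonneg hn.le]
    exact Real.pi_pos.ne

/-- Expand the exponential: the `k`-th term is the beta integral with parameters `δ` and `k + α`.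
The bounds on the real parts keep both powers at most `1` in norm, so `‖z‖^k / k!` justifies the
interchange. -/
lemma integral_beta_series {α δ : ℂ} (hα : 1 ≤ α.re) (hδ : 1 ≤ δ.re) (z : ℂ) :
    ∫ s in Set.Ioo (0 : ℝ) 1, (s : ℂ) ^ (δ - 1) * (1 - s : ℂ) ^ (α - 1)
        * Complex.exp (z * (1 - s)) = Complex.Gamma δ * series α (α + δ) z := by
  have key : ∀ k : ℕ, ∫ s in Set.Ioo (0 : ℝ) 1, (s : ℂ) ^ (δ - 1) * (1 - s : ℂ) ^ (α - 1)
      * ((z * (1 - s)) ^ k / (k.factorial : ℂ))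
      = Complex.Gamma δ * (coeff α (α + δ) k * z ^ k) := by
    intro k
    have h := Complex.betaIntegral_eq_Gamma_mul_div δ (k + α) (by linarith) (by
      simp
      linarith [(Nat.cast_nonneg k : (0 : ℝ) ≤ k)])
    rw [Complex.betaIntegral, intervalIntegral.integral_of_le zero_le_one,
      MeasureTheory.integral_Ioc_eq_integral_Ioo] at h
    calc _ = ∫ s in Set.Ioo (0 : ℝ) 1, (s : ℂ) ^ (δ - 1) * (1 - s : ℂ) ^ (k + α - 1)
          * (z ^ k / (k.factorial : ℂ)) := by
          refine MeasureTheory.setIntegral_congr_fun measurableSet_Ioo fun s hs => ?_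
          have h1 : (1 - s : ℂ) ≠ 0 := by
            have : (1 - s : ℝ) ≠ 0 := by linarith [hs.2]
            exact_mod_cast this
          rw [show (k : ℂ) + α - 1 = (α - 1) + k by ring, Complex.cpow_add _ _ h1,
            Complex.cpow_natCast, mul_pow]
          ring
      _ = _ := by
          rw [MeasureTheory.integral_mul_const, h, coeff,
            show δ + ((k : ℂ) + α) = k + (α + δ) by ring, div_mul_eq_div_div]
          ring
  have hsum := MeasureTheory.hasSum_integral_of_dominated_convergence
    (μ := MeasureTheory.volume.restrict (Set.Ioo (0 : ℝ) 1))
    (F := fun (k : ℕ) (s : ℝ) => (s : ℂ) ^ (δ - 1) * (1 - s : ℂ) ^ (α - 1)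
      * ((z * (1 - s)) ^ k / (k.factorial : ℂ)))
    (f := fun s : ℝ => (s : ℂ) ^ (δ - 1) * (1 - s : ℂ) ^ (α - 1) * Complex.exp (z * (1 - s)))
    (fun k _ => ‖z‖ ^ k / k.factorial) ?_ ?_ ?_ ?_ ?_
  · refine hsum.unique ?_
    simp only [key]
    exact (hasSum_series α (α + δ) z).mul_left _
  · intro k
    exact (by fun_prop : Measurable fun s : ℝ => (s : ℂ) ^ (δ - 1) * (1 - s : ℂ) ^ (α - 1)
      * ((z * (1 - s)) ^ k / (k.factorial : ℂ))).aestronglyMeasurable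
  · intro k
    filter_upwards [MeasureTheory.ae_restrict_mem measurableSet_Ioo] with s hs
    have h1 : (0 : ℝ) < 1 - s := by linarith [hs.2]
    have h2 : (1 - s : ℂ) = ((1 - s : ℝ) : ℂ) := by push_cast; ring
    rw [h2, norm_mul, norm_mul, Complex.norm_cpow_eq_rpow_re_of_pos hs.1,
      Complex.norm_cpow_eq_rpow_re_of_pos h1, norm_div, norm_pow, norm_mul, Complex.norm_real,
      Real.norm_of_nonneg h1.le, Complex.norm_natCast]
    have h3 : s ^ (δ - 1).re ≤ 1 := Real.rpow_le_one hs.1.le hs.2.le (by simpa using hδ)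
    have h4 : (1 - s) ^ (α - 1).re ≤ 1 :=
      Real.rpow_le_one h1.le (by linarith [hs.1]) (by simpa using hα)
    have h5 : ‖z‖ * (1 - s) ≤ ‖z‖ := by nlinarith [norm_nonneg z, hs.1]
    calc _ ≤ 1 * 1 * (‖z‖ ^ k / k.factorial) := by
          have := Real.rpow_nonneg h1.le (α - 1).re
          gcongr
      _ = _ := by ring
  · exact Eventually.of_forall fun s => Real.summable_pow_div_factorial ‖z‖
  · exact MeasureTheory.integrable_const _
  · refine Eventually.of_forall fun s => HasSum.mul_left _ ?_
    have := NormedSpace.expSeries_div_hasSum_exp (𝔸 := ℂ) (z * (1 - s))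
    rwa [← Complex.exp_eq_exp_ℂ] at this

/-- The leading asymptotics of `Γ(α) 𝐌(α, β, nζ)` as `n → ∞` and `ζ → ζ₀`. -/
def HasLeadingAsymptotics (α β : ℂ) : Prop :=
  ∀ ζ₀ : ℂ, 0 < ζ₀.re → Tendsto
    (fun p : ℕ × ℂ => series α β (p.1 * p.2) * Complex.exp (-(p.1 * p.2)) / (p.1 : ℂ) ^ (α - β))
    (atTop ×ˢ 𝓝 ζ₀) (𝓝 (ζ₀ ^ (α - β)))

/-- In the relation `series_eq_add_right` the first term is smaller by a factor `1/n`, while in the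
second the factor `z = nζ` restores the missing power. -/
lemma HasLeadingAsymptotics.of_add_right {α β : ℂ} (h1 : HasLeadingAsymptotics α (β + 1))
    (h2 : HasLeadingAsymptotics (α + 1) (β + 2)) : HasLeadingAsymptotics α β := by
  intro ζ₀ hζ
  have hinv : Tendsto (fun p : ℕ × ℂ => (p.1 : ℂ)⁻¹) (atTop ×ˢ 𝓝 ζ₀) (𝓝 0) :=
    (tendsto_inv_atTop_nhds_zero_nat (𝕜 := ℂ)).comp tendsto_fst
  have h0 : ζ₀ ≠ 0 := by
    rintro rfl
    simp at hζ
  have h := (((h1 ζ₀ hζ).mul hinv).const_mul β).add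
    ((tendsto_snd : Tendsto Prod.snd ((atTop : Filter ℕ) ×ˢ 𝓝 ζ₀) (𝓝 ζ₀)).mul (h2 ζ₀ hζ))
  rw [mul_zero, mul_zero, zero_add, show α + 1 - (β + 2) = α - β - 1 by ring,
    Complex.cpow_sub (α - β) 1 h0, Complex.cpow_one, mul_div_cancel₀ _ h0] at h
  refine h.congr' ?_
  filter_upwards [tendsto_fst.eventually (eventually_gt_atTop 0)] with p hp
  have hp' : (p.1 : ℂ) ≠ 0 := by exact_mod_cast hp.ne'
  have h5 : (p.1 : ℂ) ^ (α - β) ≠ 0 := by simp [Complex.cpow_eq_zero_iff, hp']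
  rw [series_eq_add_right α β, show α - (β + 1) = α - β - 1 by ring,
    Complex.cpow_sub (α - β) 1 hp', Complex.cpow_one]
  generalize (p.1 : ℂ) ^ (α - β) = q at *
  field_simp

/-- Here both terms of `mul_series_eq_add` have full order, with weights `β` and `α - β` adding up
to `α`, which is nonzero. -/
lemma HasLeadingAsymptotics.of_add_left {α β : ℂ} (hα : ∀ m : ℕ, α ≠ -(m : ℂ))
    (h1 : HasLeadingAsymptotics (α + 1) (β + 1))
    (h2 : HasLeadingAsymptotics (α + 1) (β + 2)) : HasLeadingAsymptotics α β := by
  intro ζ₀ hζ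
  have h0 : ζ₀ ≠ 0 := by
    rintro rfl
    simp at hζ
  have hα0 : α ≠ 0 := by simpa using hα 0
  have h := ((((h1 ζ₀ hζ).const_mul β)).add
    (((tendsto_snd : Tendsto Prod.snd ((atTop : Filter ℕ) ×ˢ 𝓝 ζ₀) (𝓝 ζ₀)).mul
      (h2 ζ₀ hζ)).const_mul (α - β))).const_mul α⁻¹
  rw [show α + 1 - (β + 1) = α - β by ring, show α + 1 - (β + 2) = α - β - 1 by ring,
    Complex.cpow_sub (α - β) 1 h0, Complex.cpow_one, mul_div_cancel₀ _ h0, ← add_mul, add_sub_cancel,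
    inv_mul_cancel_left₀ hα0] at h
  refine h.congr' ?_
  filter_upwards [tendsto_fst.eventually (eventually_gt_atTop 0)] with p hp
  have hp' : (p.1 : ℂ) ≠ 0 := by exact_mod_cast hp.ne'
  have h5 : (p.1 : ℂ) ^ (α - β) ≠ 0 := by simp [Complex.cpow_eq_zero_iff, hp']
  have h6 : series α β (p.1 * p.2) = α⁻¹ * (β * series (α + 1) (β + 1) (p.1 * p.2)
      + (α - β) * (p.1 * p.2 * series (α + 1) (β + 2) (p.1 * p.2))) := by
    rw [← mul_series_eq_add hα, inv_mul_cancel_left₀ hα0]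
  rw [h6, Complex.cpow_sub (α - β) 1 hp', Complex.cpow_one]
  generalize (p.1 : ℂ) ^ (α - β) = q at *
  field_simp

/-- The substitution `s = t/n` in the beta integral; the indicator makes the domain independent of
`n`. -/
lemma integral_beta_series_scaled {α δ : ℂ} (hα : 1 ≤ α.re) (hδ : 1 ≤ δ.re) {n : ℕ}
    (hn : 0 < n) (ζ : ℂ) :
    ∫ t in Set.Ioi (0 : ℝ), (Set.Iio (n : ℝ)).indicator (fun t : ℝ => (t : ℂ) ^ (δ - 1)
        * (1 - t / n : ℂ) ^ (α - 1) * Complex.exp (-(ζ * t))) t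
      = Complex.Gamma δ * (series α (α + δ) (n * ζ) * Complex.exp (-(n * ζ)) * (n : ℂ) ^ δ) := by
  have hn0 : (0 : ℝ) < n := by exact_mod_cast hn
  have hn' : (n : ℂ) ≠ 0 := by exact_mod_cast hn.ne'
  set g : ℝ → ℂ := (Set.Iio (1 : ℝ)).indicator (fun s : ℝ => (s : ℂ) ^ (δ - 1)
    * (1 - s : ℂ) ^ (α - 1) * Complex.exp (n * ζ * (1 - s))) with hg
  have h1 : ∫ s in Set.Ioi (0 : ℝ), g s = Complex.Gamma δ * series α (α + δ) (n * ζ) := by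
    rw [← integral_beta_series hα hδ, hg, MeasureTheory.setIntegral_indicator measurableSet_Iio]
    rfl
  have h2 := MeasureTheory.integral_comp_mul_left_Ioi g 0 (inv_pos.2 hn0)
  rw [mul_zero, inv_inv, h1] at h2
  have h3 : ∀ t ∈ Set.Ioi (0 : ℝ), (Set.Iio (n : ℝ)).indicator (fun t : ℝ => (t : ℂ) ^ (δ - 1)
        * (1 - t / n : ℂ) ^ (α - 1) * Complex.exp (-(ζ * t))) t
      = Complex.exp (-(n * ζ)) * (n : ℂ) ^ (δ - 1) * g ((n : ℝ)⁻¹ * t) := by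
    intro t ht
    have h4 : (n : ℝ)⁻¹ * t < 1 ↔ t < n := by rw [inv_mul_lt_iff₀ hn0, mul_one]
    by_cases htn : t < n
    · rw [hg, Set.indicator_of_mem (by exact htn), Set.indicator_of_mem (by exact h4.2 htn)]
      have h5 : (t : ℂ) ^ (δ - 1)
          = (n : ℂ) ^ (δ - 1) * (((n : ℝ)⁻¹ * t : ℝ) : ℂ) ^ (δ - 1) := by
        rw [← Complex.ofReal_natCast,
          ← Complex.mul_cpow_ofReal_nonneg hn0.le (by have : (0 : ℝ) < t := ht; positivity)]
        congr 1
        push_cast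
        field_simp
      rw [h5, show (1 - (((n : ℝ)⁻¹ * t : ℝ) : ℂ)) = 1 - t / n by push_cast; ring,
        show (n : ℂ) * ζ * (1 - t / n) = n * ζ + -(ζ * t) by field_simp; ring, Complex.exp_add]
      have h7 : Complex.exp (-(n * ζ)) * Complex.exp (n * ζ) = 1 := by
        rw [← Complex.exp_add]
        simp
      linear_combination (-((n : ℂ) ^ (δ - 1) * (((n : ℝ)⁻¹ * t : ℝ) : ℂ) ^ (δ - 1)
        * (1 - t / n : ℂ) ^ (α - 1) * Complex.exp (-(ζ * t)))) * h7
    · rw [hg, Set.indicator_of_notMem (by exact htn), Set.indicator_of_notMem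
        (by exact fun h => htn (h4.1 h)), mul_zero]
  rw [MeasureTheory.setIntegral_congr_fun measurableSet_Ioi h3, MeasureTheory.integral_const_mul,
    h2, Complex.cpow_sub _ _ hn', Complex.cpow_one, Complex.real_smul, Complex.ofReal_natCast]
  field_simp

/-- Dominated convergence: `(1 - t/n)^{α-1}` is bounded by `1` and tends to `1`, leaving the Laplace
transform of `t^{δ-1}`. Decay at rate `Re ζ₀ / 2` serves all `ζ` near `ζ₀`. -/
lemma hasLeadingAsymptotics_base {α δ : ℂ} (hα : 1 ≤ α.re) (hδ : 1 ≤ δ.re) :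
    HasLeadingAsymptotics α (α + δ) := by
  intro ζ₀ hζ
  have hG : Complex.Gamma δ ≠ 0 := Complex.Gamma_ne_zero_of_re_pos (by linarith)
  have hre : ∀ᶠ p : ℕ × ℂ in atTop ×ˢ 𝓝 ζ₀, ζ₀.re / 2 < p.2.re :=
    tendsto_snd.eventually ((isOpen_lt continuous_const Complex.continuous_re).mem_nhds
      (show ζ₀.re / 2 < ζ₀.re by linarith))
  have hpos : ∀ᶠ p : ℕ × ℂ in atTop ×ˢ 𝓝 ζ₀, 0 < p.1 :=
    tendsto_fst.eventually (eventually_gt_atTop 0)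
  have h := MeasureTheory.tendsto_integral_filter_of_dominated_convergence
    (μ := MeasureTheory.volume.restrict (Set.Ioi (0 : ℝ))) (l := atTop ×ˢ 𝓝 ζ₀)
    (F := fun (p : ℕ × ℂ) (t : ℝ) => (Set.Iio (p.1 : ℝ)).indicator (fun t : ℝ =>
      (t : ℂ) ^ (δ - 1) * (1 - t / p.1 : ℂ) ^ (α - 1) * Complex.exp (-(p.2 * t))) t)
    (f := fun t : ℝ => (t : ℂ) ^ (δ - 1) * Complex.exp (-(ζ₀ * t)))
    (fun t => t ^ (δ - 1).re * Real.exp (-(ζ₀.re / 2 * t)))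
    (Eventually.of_forall fun p => ((by fun_prop : Measurable fun t : ℝ =>
      (t : ℂ) ^ (δ - 1) * (1 - t / p.1 : ℂ) ^ (α - 1)
        * Complex.exp (-(p.2 * t))).indicator measurableSet_Iio).aestronglyMeasurable)
    ?_ (integrableOn_rpow_mul_exp_neg (by simp; linarith) (by linarith)) ?_
  · rw [integral_cpow_mul_exp_neg_mul (by linarith) hζ] at h
    have h2 := h.const_mul (Complex.Gamma δ)⁻¹
    rw [mul_comm (ζ₀ ^ (-δ)), inv_mul_cancel_left₀ hG] at h2
    rw [show α - (α + δ) = -δ by ring]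
    refine h2.congr' ?_
    filter_upwards [hpos] with p hp
    rw [integral_beta_series_scaled hα hδ hp, inv_mul_cancel_left₀ hG, Complex.cpow_neg,
      div_inv_eq_mul]
  · filter_upwards [hre, hpos] with p hp hp0
    have hn0 : (0 : ℝ) < p.1 := by exact_mod_cast hp0
    filter_upwards [MeasureTheory.ae_restrict_mem measurableSet_Ioi] with t ht
    have ht' : (0 : ℝ) < t := ht
    by_cases htn : t < p.1
    · rw [Set.indicator_of_mem (by exact htn)]
      have h1 : (0 : ℝ) < 1 - t / p.1 := by
        rw [sub_pos, div_lt_one hn0]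
        exact htn
      have h2 : (1 - t / p.1 : ℂ) = ((1 - t / p.1 : ℝ) : ℂ) := by push_cast; ring
      rw [mul_right_comm, norm_mul, norm_cpow_mul_exp_neg ht', h2,
        Complex.norm_cpow_eq_rpow_re_of_pos h1]
      have h4 : (1 - t / p.1) ^ (α - 1).re ≤ 1 :=
        Real.rpow_le_one h1.le (by linarith [div_pos ht' hn0]) (by simpa using hα)
      calc _ ≤ t ^ (δ - 1).re * Real.exp (-(p.2.re * t)) * 1 := by gcongr
        _ ≤ _ := by
          rw [mul_one]
          gcongr
    · rw [Set.indicator_of_notMem (by exact htn), norm_zero]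
      positivity
  · filter_upwards [MeasureTheory.ae_restrict_mem measurableSet_Ioi] with t ht
    have h1 : Tendsto (fun p : ℕ × ℂ => (1 - t / p.1 : ℂ) ^ (α - 1)) (atTop ×ˢ 𝓝 ζ₀) (𝓝 1) := by
      have h2 : Tendsto (fun p : ℕ × ℂ => (1 - t / p.1 : ℂ)) (atTop ×ˢ 𝓝 ζ₀) (𝓝 (1 - 0)) :=
        tendsto_const_nhds.sub ((tendsto_const_div_atTop_nhds_zero_nat (t : ℂ)).comp tendsto_fst)
      have h3 := h2.cpow (tendsto_const_nhds (x := α - 1)) (by simp)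
      simpa using h3
    have h2 : Tendsto (fun p : ℕ × ℂ => Complex.exp (-(p.2 * t))) (atTop ×ˢ 𝓝 ζ₀)
        (𝓝 (Complex.exp (-(ζ₀ * t)))) :=
      ((by fun_prop : Continuous fun ζ : ℂ => Complex.exp (-(ζ * t))).tendsto ζ₀).comp tendsto_snd
    have h3 := ((tendsto_const_nhds (x := (t : ℂ) ^ (δ - 1))).mul h1).mul h2
    rw [mul_one] at h3
    refine h3.congr' ?_
    filter_upwards [(tendsto_natCast_atTop_atTop (R := ℝ).comp tendsto_fst).eventually
      (eventually_gt_atTop t)] with p hp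
    rw [Set.indicator_of_mem (by exact hp)]

/-- Two inductions starting from the beta integral: the first relaxes the lower bound on `Re (β -
α)` while keeping `Re α ≥ 1`, the second relaxes the bound on `Re α` for all `β` at once. -/
theorem hasLeadingAsymptotics {α : ℂ} (hα : ∀ m : ℕ, α ≠ -(m : ℂ)) (β : ℂ) :
    HasLeadingAsymptotics α β := by
  have h1 : ∀ m : ℕ, ∀ α β : ℂ, 1 ≤ α.re → 1 - (m : ℝ) ≤ (β - α).re →
      HasLeadingAsymptotics α β := by
    intro m
    induction m with
    | zero =>
      intro α β hα hβ
      have := hasLeadingAsymptotics_base (δ := β - α) hα (by simpa using hβ)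
      rwa [add_sub_cancel] at this
    | succ m ih =>
      intro α β hα hβ
      push_cast at hβ
      refine .of_add_right (ih _ _ hα ?_) (ih _ _ ?_ ?_)
      · rw [show β + 1 - α = β - α + 1 by ring, Complex.add_re, Complex.one_re]
        linarith
      · rw [Complex.add_re, Complex.one_re]
        linarith
      · rw [show β + 2 - (α + 1) = β - α + 1 by ring, Complex.add_re, Complex.one_re]
        linarith
  have h2 : ∀ m : ℕ, ∀ α β : ℂ, (∀ m : ℕ, α ≠ -(m : ℂ)) → 1 - (m : ℝ) ≤ α.re →
      HasLeadingAsymptotics α β := by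
    intro m
    induction m with
    | zero =>
      intro α β _ hα
      obtain ⟨k, hk⟩ := exists_nat_ge (1 - (β - α).re)
      exact h1 k α β (by simpa using hα) (by linarith)
    | succ m ih =>
      intro α β hα hm
      push_cast at hm
      have h3 : ∀ m : ℕ, α + 1 ≠ -(m : ℂ) := fun m h => hα (m + 1) (by
        push_cast
        linear_combination h)
      have h4 : 1 - (m : ℝ) ≤ (α + 1).re := by
        rw [Complex.add_re, Complex.one_re]
        linarith
      exact .of_add_left hα (ih _ _ h3 h4) (ih _ _ h3 h4)
  obtain ⟨k, hk⟩ := exists_nat_ge (1 - α.re)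
  exact h2 k α β hα (by linarith)

/-! ### Slowly varying sequences and summation by parts -/

/-- A sequence `u` with `u 0 = 1` and ratios `q` close to `1` on the scale `N ≥ n`, with Gaussian
decay on that scale. -/
structure SlowRecurrence (u q : ℕ → ℂ) (N : ℕ → ℝ) (n B D : ℝ) : Prop where
  one_le : 1 ≤ n
  le_scale : ∀ j, n ≤ N j
  zero : u 0 = 1
  succ : ∀ j, u (j + 1) = q j * u j
  norm_sub_one_le : ∀ j : ℕ, ‖q j - 1‖ ≤ B * (j + 1) / N j
  norm_sub_le : ∀ j, ‖q (j + 1) - q j‖ ≤ B / N j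
  norm_ratio_le : ∀ j, ‖q j‖ ≤ B
  decay : ∀ j : ℕ, ‖u j‖ ≤ D * Real.exp (-((j : ℝ) ^ 2 / (4 * N j)))

/-- The second difference is `u_j` times a quantity of size `1/N + (j+1)²/N²`, that is `(x +
x²)/(j+1)²` with `x = (j+1)²/N`. Gaussian decay in `x` absorbs the numerator, which leaves a
summable bound free of `N`. -/
lemma SlowRecurrence.norm_second_diff_le {u q : ℕ → ℂ} {N : ℕ → ℝ} {n B D : ℝ}
    (h : SlowRecurrence u q N n B D) (j : ℕ) :
    ‖u (j + 2) - 2 * u (j + 1) + u j‖ ≤ 384 * B ^ 2 * D / ((j : ℝ) + 1) ^ 2 := by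
  have hN : 1 ≤ N j := h.one_le.trans (h.le_scale j)
  have hN0 : 0 < N j := by linarith
  have hj : (0 : ℝ) < (j : ℝ) + 1 := by positivity
  have hB : 0 ≤ B := (norm_nonneg _).trans (h.norm_ratio_le 0)
  have hD : 0 ≤ D := by
    have := (norm_nonneg _).trans (h.decay 0)
    simpa using this
  set x : ℝ := ((j : ℝ) + 1) ^ 2 / N j with hx
  have hx0 : 0 ≤ x := by positivity
  have e1 : u (j + 2) - 2 * u (j + 1) + u j
      = u j * ((q (j + 1) - q j) * q j + (q j - 1) * (q j - 1)) := by
    rw [h.succ (j + 1), h.succ j]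
    ring
  have e2 : ‖(q (j + 1) - q j) * q j + (q j - 1) * (q j - 1)‖
      ≤ B ^ 2 * (x + x ^ 2) / ((j : ℝ) + 1) ^ 2 := by
    calc _ ≤ ‖q (j + 1) - q j‖ * ‖q j‖ + ‖q j - 1‖ * ‖q j - 1‖ := by
          rw [← norm_mul, ← norm_mul]
          exact norm_add_le _ _
      _ ≤ B / N j * B + (B * (j + 1) / N j) * (B * (j + 1) / N j) := by
          gcongr
          · exact h.norm_sub_le j
          · exact h.norm_ratio_le j
          · exact h.norm_sub_one_le j
          · exact h.norm_sub_one_le j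
      _ = _ := by
          rw [hx]
          field_simp
  -- Passing from `j` to `j + 1` halves the rate and costs a factor `e ≤ 3`.
  have e3 : ‖u j‖ ≤ D * (3 * Real.exp (-(x / 8))) := by
    refine (h.decay j).trans (mul_le_mul_of_nonneg_left ?_ hD)
    have h1 : -((j : ℝ) ^ 2 / (4 * N j)) ≤ 1 + -(x / 8) := by
      have h2 : x / 8 ≤ (j : ℝ) ^ 2 / (4 * N j) + 1 := by
        rw [hx, div_div, div_add_one (by positivity), div_le_div_iff₀ (by positivity)
          (by positivity)]
        nlinarith [sq_nonneg ((j : ℝ) - 1), mul_pos hN0 hN0]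
      linarith
    calc _ ≤ Real.exp (1 + -(x / 8)) := Real.exp_le_exp.2 h1
      _ = Real.exp 1 * Real.exp (-(x / 8)) := Real.exp_add _ _
      _ ≤ _ := by
        gcongr
        linarith [Real.exp_one_lt_d9]
  have e4 : (x + x ^ 2) * Real.exp (-(x / 8)) ≤ 128 := by
    rw [Real.exp_neg, ← div_eq_mul_inv, div_le_iff₀ (Real.exp_pos _)]
    nlinarith [Real.quadratic_le_exp_of_nonneg (show 0 ≤ x / 8 by positivity)]
  rw [e1, norm_mul]
  calc _ ≤ D * (3 * Real.exp (-(x / 8))) * (B ^ 2 * (x + x ^ 2) / ((j : ℝ) + 1) ^ 2) := by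
        gcongr
    _ = 3 * B ^ 2 * D * ((x + x ^ 2) * Real.exp (-(x / 8))) / ((j : ℝ) + 1) ^ 2 := by ring
    _ ≤ 3 * B ^ 2 * D * 128 / ((j : ℝ) + 1) ^ 2 := by gcongr
    _ = _ := by ring

lemma tendsto_one_of_slowRecurrence {u q : ℕ → ℕ → ℂ} {N : ℕ → ℕ → ℝ} {B D : ℝ}
    (h : ∀ᶠ n : ℕ in atTop, SlowRecurrence (u n) (q n) (N n) n B D) (j : ℕ) :
    Tendsto (fun n => u n j) atTop (𝓝 1) := by
  induction j with
  | zero =>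
    refine tendsto_const_nhds.congr' ?_
    filter_upwards [h] with n hn
    exact hn.zero.symm
  | succ j ih =>
    have hq : Tendsto (fun n => q n j) atTop (𝓝 1) := by
      rw [tendsto_iff_norm_sub_tendsto_zero]
      refine squeeze_zero' (Eventually.of_forall fun n => norm_nonneg _) ?_
        (tendsto_const_div_atTop_nhds_zero_nat (B * (j + 1)))
      filter_upwards [h] with n hn
      refine (hn.norm_sub_one_le j).trans ?_
      have hB : 0 ≤ B := (norm_nonneg _).trans (hn.norm_ratio_le 0)
      have h1 := hn.one_le
      have h2 := hn.le_scale j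
      gcongr
    have h2 := hq.mul ih
    rw [one_mul] at h2
    refine h2.congr' ?_
    filter_upwards [h] with n hn
    exact (hn.succ j).symm

lemma summable_mul_pow_of_norm_le_one {u : ℕ → ℂ} (hu : Summable u) {ζ : ℂ} (hζ : ‖ζ‖ ≤ 1) :
    Summable fun j => u j * ζ ^ j := by
  refine Summable.of_norm_bounded hu.norm fun j => ?_
  rw [norm_mul, norm_pow]
  exact mul_le_of_le_one_right (norm_nonneg _) (pow_le_one₀ (norm_nonneg _) hζ)

/-- Each factor `1 - ζ` is one summation by parts. Two are needed: the bound on first differences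
that is uniform in the scale is only of order `1/j`. -/
lemma sq_one_sub_mul_tsum {u : ℕ → ℂ} {ζ : ℂ} (hs : Summable fun j => u j * ζ ^ j) :
    (1 - ζ) ^ 2 * ∑' j, u j * ζ ^ j = u 0 + (u 1 - 2 * u 0) * ζ
      + ∑' j, (u (j + 2) - 2 * u (j + 1) + u j) * ζ ^ (j + 2) := by
  have h0 := hs.hasSum
  set S := ∑' j, u j * ζ ^ j
  have h1 : HasSum (fun j => u (j + 1) * ζ ^ (j + 1)) (S - u 0) := by
    simpa using (hasSum_nat_add_iff' 1).2 h0
  have h2 : HasSum (fun j => u (j + 2) * ζ ^ (j + 2)) (S - (u 0 + u 1 * ζ)) := by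
    simpa [Finset.sum_range_succ] using (hasSum_nat_add_iff' 2).2 h0
  have h3 := (h2.sub (h1.mul_left (2 * ζ))).add (h0.mul_left (ζ ^ 2))
  have h4 : HasSum (fun j => (u (j + 2) - 2 * u (j + 1) + u j) * ζ ^ (j + 2))
      (S - (u 0 + u 1 * ζ) - 2 * ζ * (S - u 0) + ζ ^ 2 * S) :=
    h3.congr_fun fun j => by ring
  rw [h4.tsum_eq]
  ring

/-- Two summations by parts: the generating functions of slowly varying sequences tend to the
geometric series on the closed unit disc away from `1`. -/
lemma tendsto_tsum_of_slowRecurrence {ι : Type*} {l : Filter ι} {u q : ℕ → ℕ → ℂ}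
    {N : ℕ → ℕ → ℝ} {B D : ℝ}
    (h : ∀ᶠ n : ℕ in atTop, SlowRecurrence (u n) (q n) (N n) n B D)
    (hs : ∀ᶠ n : ℕ in atTop, Summable (u n)) {k : ι → ℕ} (hk : Tendsto k l atTop) {ζ : ι → ℂ}
    {ζ₀ : ℂ} (hζ : Tendsto ζ l (𝓝 ζ₀)) (hζ1 : ∀ᶠ i in l, ‖ζ i‖ ≤ 1) (hζ₀ : ζ₀ ≠ 1) :
    Tendsto (fun i => ∑' j, u (k i) j * ζ i ^ j) l (𝓝 (1 - ζ₀)⁻¹) := by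
  have hu : ∀ j, Tendsto (fun i => u (k i) j) l (𝓝 1) := fun j =>
    (tendsto_one_of_slowRecurrence h j).comp hk
  have hsum : Summable fun j : ℕ => 384 * B ^ 2 * D / ((j : ℝ) + 1) ^ 2 := by
    have := ((summable_nat_add_iff 1).2
      (Real.summable_one_div_nat_pow.2 one_lt_two)).mul_left (384 * B ^ 2 * D)
    refine this.congr fun j => ?_
    push_cast
    ring
  have h1 : Tendsto (fun i => ∑' j, (u (k i) (j + 2) - 2 * u (k i) (j + 1) + u (k i) j)
      * ζ i ^ (j + 2)) l (𝓝 (∑' j : ℕ, 0)) := by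
    refine tendsto_tsum_of_dominated_convergence hsum (fun j => ?_) ?_
    · have := (((hu (j + 2)).sub ((hu (j + 1)).const_mul 2)).add (hu j)).mul (hζ.pow (j + 2))
      convert! this using 2
      norm_num
    · filter_upwards [hk.eventually h, hζ1] with i hi hi1 j
      rw [norm_mul, norm_pow]
      exact (mul_le_of_le_one_right (norm_nonneg _) (pow_le_one₀ (norm_nonneg _) hi1)).trans
        (hi.norm_second_diff_le j)
  have h2 := ((hu 0).add (((hu 1).sub ((hu 0).const_mul 2)).mul hζ)).add h1
  have hne : 1 - ζ₀ ≠ 0 := sub_ne_zero.2 hζ₀.symm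
  have h3 := h2.div ((tendsto_const_nhds (x := (1 : ℂ)).sub hζ).pow 2) (pow_ne_zero 2 hne)
  have h4 : (1 + (1 - 2 * 1) * ζ₀ + ∑' _ : ℕ, (0 : ℂ)) / (1 - ζ₀) ^ 2 = (1 - ζ₀)⁻¹ := by
    rw [tsum_zero]
    field_simp
    ring
  rw [h4] at h3
  refine h3.congr' ?_
  filter_upwards [hk.eventually hs, hζ1, hζ.eventually_ne hζ₀] with i hi hi1 hi2
  have hne : 1 - ζ i ≠ 0 := sub_ne_zero.2 hi2.symm
  rw [Pi.div_apply, ← sq_one_sub_mul_tsum (summable_mul_pow_of_norm_le_one hi hi1),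
    mul_div_cancel_left₀ _ (pow_ne_zero 2 hne)]

/-! ### The tail and the reversed partial sum as slow recurrences -/

lemma eventually_add_ne_zero (c : ℂ) : ∀ᶠ k : ℕ in atTop, (k : ℂ) + c ≠ 0 := by
  filter_upwards [eventually_half_le_norm_add c, eventually_gt_atTop 0] with k h hk h0
  have : (0 : ℝ) < k := by exact_mod_cast hk
  rw [h0, norm_zero] at h
  linarith

lemma eventually_coeff_ne_zero {α : ℂ} (hα : ∀ m : ℕ, α ≠ -(m : ℂ)) (β : ℂ) :
    ∀ᶠ k : ℕ in atTop, coeff α β k ≠ 0 := by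
  obtain ⟨K, hK⟩ := exists_nat_gt (-β.re)
  filter_upwards [eventually_ge_atTop K] with k hk
  have hk' : (K : ℝ) ≤ k := by exact_mod_cast hk
  have h1 : Complex.Gamma (k + β) ≠ 0 := Complex.Gamma_ne_zero_of_re_pos (by
    simp
    linarith)
  exact div_ne_zero (Gamma_natCast_add_ne_zero hα k)
    (mul_ne_zero h1 (by exact_mod_cast Nat.factorial_ne_zero k))

/-- The coefficients of the normalized tail of the series. -/
noncomputable def forwardCoeff (α β : ℂ) (n j : ℕ) : ℂ :=
  coeff α β (n + j) * (n : ℂ) ^ j / coeff α β n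

/-- The ratios of consecutive terms of `forwardCoeff`. -/
noncomputable def forwardRatio (α β : ℂ) (n j : ℕ) : ℂ :=
  (n : ℂ) / (n + j + 1) * (1 + (α - β) / ((n + j : ℕ) + β))

lemma norm_natCast_add_add_one (n j : ℕ) : ‖(n : ℂ) + j + 1‖ = n + j + 1 := by
  have := Complex.norm_natCast (n + j + 1)
  push_cast at this
  exact this

/-- The factor is `1 - y ≤ e^{-y}` with `y = (j+1)/(n+j+1)`, and `y` is at least the increment of
the Gaussian exponent. -/
lemma gaussian_step {n : ℝ} (hn : 0 < n) (j : ℕ) :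
    n / (n + j + 1) * Real.exp (-((j : ℝ) ^ 2 / (2 * (n + j))))
      ≤ Real.exp (-(((j + 1 : ℕ) : ℝ) ^ 2 / (2 * (n + (j + 1 : ℕ))))) := by
  have hj : (0 : ℝ) ≤ j := Nat.cast_nonneg j
  have h1 : n / (n + j + 1) ≤ Real.exp (-((j + 1) / (n + j + 1))) := by
    have := Real.add_one_le_exp (-(((j : ℝ) + 1) / (n + j + 1)))
    refine le_trans (le_of_eq ?_) this
    field_simp
    ring
  have h2 : ((j : ℝ) + 1) ^ 2 / (2 * (n + (j + 1)))
      ≤ (j + 1) / (n + j + 1) + (j : ℝ) ^ 2 / (2 * (n + j)) := by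
    have h3 : (j + 1) / (n + j + 1) + (j : ℝ) ^ 2 / (2 * (n + j))
        - ((j : ℝ) + 1) ^ 2 / (2 * (n + (j + 1)))
        = (n + j + j ^ 2) / (2 * (n + j) * (n + j + 1)) := by
      field_simp
      ring
    have h4 : 0 ≤ (n + j + j ^ 2) / (2 * (n + j) * (n + j + 1)) := by positivity
    linarith
  calc _ ≤ Real.exp (-((j + 1) / (n + j + 1))) * Real.exp (-((j : ℝ) ^ 2 / (2 * (n + j)))) := by
        gcongr
    _ = Real.exp (-((j + 1) / (n + j + 1)) + -((j : ℝ) ^ 2 / (2 * (n + j)))) :=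
        (Real.exp_add _ _).symm
    _ ≤ _ := by
        push_cast
        gcongr
        linarith

/-- For `j ≤ n` the linear term is at most `A`. For `j ≥ n` half of the Gaussian exponent is at
least `j/8`, which beats `A j / n`. -/
lemma linear_sub_gaussian_le {A n : ℝ} (hA : 0 ≤ A) (hn : 0 < n) (hnA : 8 * A ≤ n) (j : ℕ) :
    A * j / n - (j : ℝ) ^ 2 / (2 * (n + j)) ≤ A - (j : ℝ) ^ 2 / (4 * (n + j)) := by
  have hj : (0 : ℝ) ≤ j := Nat.cast_nonneg j
  have h1 : (j : ℝ) ^ 2 / (2 * (n + j)) = (j : ℝ) ^ 2 / (4 * (n + j)) + (j : ℝ) ^ 2 / (4 * (n + j)) := by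
    field_simp
    ring
  have h2 : A * j / n ≤ A + (j : ℝ) ^ 2 / (4 * (n + j)) := by
    rcases le_total (j : ℝ) n with h | h
    · have h3 : A * j / n ≤ A := by
        rw [div_le_iff₀ hn]
        gcongr
      have : 0 ≤ (j : ℝ) ^ 2 / (4 * (n + j)) := by positivity
      linarith
    · have h3 : A * j / n ≤ j / 8 := by
        rw [div_le_div_iff₀ hn (by norm_num)]
        nlinarith
      have h4 : (j : ℝ) / 8 ≤ (j : ℝ) ^ 2 / (4 * (n + j)) := by
        rw [div_le_div_iff₀ (by norm_num) (by positivity)]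
        nlinarith
      linarith
  linarith

/-- The ratios are `n/(n+j+1)` up to a factor `1 + O(1/(n+j))`. The scale `n + j` is forced by
indices `j` beyond `n`, where the bound decays only exponentially. The accumulated correction
`e^{Aj/n}` is paid for with half of the Gaussian exponent. -/
lemma exists_slowRecurrence_forward {α : ℂ} (hα : ∀ m : ℕ, α ≠ -(m : ℂ)) (β : ℂ) :
    ∃ B D : ℝ, ∀ᶠ n : ℕ in atTop, SlowRecurrence (forwardCoeff α β n) (forwardRatio α β n)
      (fun j => n + j) n B D := by
  -- The factor `2` comes from `‖n + j + β‖ ≥ (n + j) / 2`.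
  set A : ℝ := 2 * ‖α - β‖ with hA
  have hA0 : 0 ≤ A := by positivity
  refine ⟨1 + 2 * A, Real.exp A, ?_⟩
  filter_upwards [eventually_forall_ge_atTop.2 (eventually_coeff_ne_zero hα β),
    eventually_forall_ge_atTop.2 (eventually_half_le_norm_add β), eventually_ge_atTop 1,
    eventually_forall_ge_atTop.2 (eventually_add_ne_zero β), eventually_ge_atTop ⌈8 * A⌉₊]
    with n hc hb hn1 hb0 hnA
  have hn : (1 : ℝ) ≤ n := by exact_mod_cast hn1
  have hn0 : (0 : ℝ) < n := by linarith
  have hnA' : 8 * A ≤ n := Nat.ceil_le.1 hnA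
  set e : ℕ → ℂ := fun j => (α - β) / ((n + j : ℕ) + β) with he
  have hq : ∀ j, forwardRatio α β n j = (n : ℂ) / (n + j + 1) * (1 + e j) := fun j => rfl
  have he1 : ∀ j : ℕ, ‖e j‖ ≤ A / (n + j) := by
    intro j
    have h1 := hb (n + j) (by simp)
    have h2 : (0 : ℝ) < n + j := by positivity
    push_cast at h1
    rw [he, norm_div]
    push_cast
    rw [div_le_div_iff₀ (by linarith) h2, hA]
    nlinarith [norm_nonneg (α - β)]
  have hd : ∀ j : ℕ, ‖(n : ℂ) / (n + j + 1)‖ = n / (n + j + 1) := by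
    intro j
    rw [norm_div, norm_natCast_add_add_one, Complex.norm_natCast]
  have hd1 : ∀ j : ℕ, (n : ℝ) / (n + j + 1) ≤ 1 := fun j => by
    rw [div_le_one (by positivity)]
    linarith [(Nat.cast_nonneg j : (0 : ℝ) ≤ j)]
  have hne : ∀ j : ℕ, (n : ℂ) + j + 1 ≠ 0 := fun j => by
    exact_mod_cast Nat.succ_ne_zero (n + j)
  have he2 : ∀ j, ‖e j‖ ≤ A / n := fun j => (he1 j).trans (by gcongr; simp)
  have hqn : ∀ j : ℕ, ‖forwardRatio α β n j‖ ≤ n / (n + j + 1) * (1 + A / n) := by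
    intro j
    rw [hq, norm_mul, hd]
    gcongr
    refine (norm_add_le _ _).trans ?_
    rw [norm_one]
    linarith [he2 j]
  have hzero : forwardCoeff α β n 0 = 1 := by
    simp [forwardCoeff, hc n le_rfl]
  have hsucc : ∀ j, forwardCoeff α β n (j + 1)
      = forwardRatio α β n j * forwardCoeff α β n j := by
    intro j
    have h1 := coeff_succ β (natCast_add_ne_zero hα (n + j))
    have h2 := hb0 (n + j) (by simp)
    have h3 := hne j
    have h4 := hc n le_rfl
    have h5 : coeff α β (n + j + 1)
        = 1 / (n + j + 1) * (1 + (α - β) / ((n + j : ℕ) + β)) * coeff α β (n + j) := by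
      have h6 : ((n + j : ℕ) : ℂ) + 1 ≠ 0 := by
        push_cast
        exact h3
      rw [eq_comm, ← sub_eq_zero]
      have : (1 + (α - β) / ((n + j : ℕ) + β)) = ((n + j : ℕ) + α) / ((n + j : ℕ) + β) := by
        field_simp
        ring
      rw [this, show (n : ℂ) + j + 1 = ((n + j : ℕ) : ℂ) + 1 by push_cast; ring]
      field_simp
      linear_combination -h1
    rw [forwardCoeff, forwardCoeff, forwardRatio, ← add_assoc, h5, pow_succ]
    ring
  refine ⟨hn, fun j => by simp, hzero, hsucc, fun j => ?_, fun j => ?_, fun j => ?_, fun j => ?_⟩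
  · have h1 : forwardRatio α β n j - 1 = -((j + 1 : ℂ) / (n + j + 1)) + (n : ℂ) / (n + j + 1) * e j := by
      rw [hq]
      have := hne j
      field_simp
      ring
    have h2 : ‖(j + 1 : ℂ) / (n + j + 1)‖ = (j + 1) / (n + j + 1) := by
      have := Complex.norm_natCast (j + 1)
      push_cast at this
      rw [norm_div, norm_natCast_add_add_one, this]
    rw [h1]
    calc _ ≤ ((j : ℝ) + 1) / (n + j + 1) + 1 * (A / (n + j)) := by
          refine (norm_add_le _ _).trans ?_
          rw [norm_neg, h2, norm_mul, hd]
          gcongr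
          · exact hd1 j
          · exact he1 j
      _ ≤ ((j : ℝ) + 1) / (n + j) + 2 * A * (j + 1) / (n + j) := by
          have : 1 * (A / (n + j)) ≤ 2 * A * (j + 1) / (n + j) := by
            rw [one_mul]
            gcongr
            nlinarith [(Nat.cast_nonneg j : (0 : ℝ) ≤ j)]
          exact add_le_add (div_le_div_of_nonneg_left (by positivity) (by positivity)
            (by linarith)) this
      _ = _ := by ring
  · have h1 : forwardRatio α β n (j + 1) - forwardRatio α β n j
        = -((n : ℂ) / (n + j + 1) * (1 / (n + (j + 1 : ℕ) + 1)))
          + (n : ℂ) / (n + (j + 1 : ℕ) + 1) * e (j + 1) - (n : ℂ) / (n + j + 1) * e j := by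
      rw [hq, hq]
      have h3 := hne j
      have h4 := hne (j + 1)
      have h5 : (n : ℂ) / (n + (j + 1 : ℕ) + 1) - (n : ℂ) / (n + j + 1)
          = -((n : ℂ) / (n + j + 1) * (1 / (n + (j + 1 : ℕ) + 1))) := by
        rw [div_sub_div _ _ h4 h3]
        field_simp
        push_cast
        ring
      linear_combination h5
    have h2 : ‖1 / ((n : ℂ) + (j + 1 : ℕ) + 1)‖ ≤ 1 / (n + j) := by
      rw [norm_div, norm_one, norm_natCast_add_add_one]
      refine div_le_div_of_nonneg_left zero_le_one (by positivity) ?_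
      push_cast
      linarith
    rw [h1]
    calc _ ≤ 1 * (1 / ((n : ℝ) + j)) + 1 * (A / (n + j)) + 1 * (A / (n + j)) := by
          refine (norm_sub_le _ _).trans (add_le_add ((norm_add_le _ _).trans
            (add_le_add ?_ ?_)) ?_)
          · rw [norm_neg, norm_mul, hd]
            gcongr
            exact hd1 j
          · rw [norm_mul, hd]
            gcongr
            · exact hd1 (j + 1)
            · refine (he1 (j + 1)).trans ?_
              push_cast
              gcongr
              linarith
          · rw [norm_mul, hd]
            gcongr
            · exact hd1 j
            · exact he1 j
      _ = _ := by ring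
  · refine (hqn j).trans ?_
    have : A / n ≤ A := div_le_self hA0 hn
    calc _ ≤ 1 * (1 + A / n) := by
          gcongr
          exact hd1 j
      _ ≤ _ := by linarith
  · have h1 : ∀ j : ℕ, ‖forwardCoeff α β n j‖
        ≤ Real.exp (A * j / n) * Real.exp (-((j : ℝ) ^ 2 / (2 * (n + j)))) := by
      intro j
      induction j with
      | zero => simp [hzero]
      | succ j ih =>
        rw [hsucc, norm_mul]
        have h2 : 1 + A / n ≤ Real.exp (A / n) := by
          rw [add_comm]
          exact Real.add_one_le_exp _
        calc _ ≤ (n / (n + j + 1) * Real.exp (A / n))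
              * (Real.exp (A * j / n) * Real.exp (-((j : ℝ) ^ 2 / (2 * (n + j))))) := by
              gcongr
              exact (hqn j).trans (by gcongr)
          _ = (Real.exp (A / n) * Real.exp (A * j / n))
              * (n / (n + j + 1) * Real.exp (-((j : ℝ) ^ 2 / (2 * (n + j))))) := by ring
          _ ≤ _ := by
              rw [← Real.exp_add, show A / n + A * j / n = A * (j + 1 : ℕ) / n by push_cast; ring]
              gcongr
              exact gaussian_step hn0 j
    refine (h1 j).trans ?_
    rw [← Real.exp_add, ← Real.exp_add]
    exact Real.exp_le_exp.2 (by linarith [linear_sub_gaussian_le hA0 hn0 hnA' j])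

lemma summable_forwardCoeff (α β : ℂ) (n : ℕ) : Summable (forwardCoeff α β n) := by
  rcases Nat.eq_zero_or_pos n with rfl | hn
  · refine summable_of_hasFiniteSupport ((Set.finite_singleton 0).subset fun j hj => ?_)
    by_contra h
    have h' : j ≠ 0 := h
    simp [forwardCoeff, h'] at hj
  · have hn' : (n : ℂ) ≠ 0 := by exact_mod_cast hn.ne'
    have h := (((summable_nat_add_iff n).2 (summable_coeff_mul_pow α β n)).mul_right
      ((n : ℂ) ^ n)⁻¹).div_const (coeff α β n)
    refine h.congr fun j => ?_
    rw [forwardCoeff, pow_add, add_comm j n]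
    have := pow_ne_zero n hn'
    field_simp

/-- The coefficients of the normalized reversed partial sum. -/
noncomputable def backwardCoeff (α β : ℂ) (n j : ℕ) : ℂ :=
  if j < n then coeff α β (n - 1 - j) / (coeff α β (n - 1) * (n : ℂ) ^ j) else 0

/-- The deviation of `k coeff k⁻¹ coeff (k - 1)` from `k ^ 2`, divided by `k`. -/
noncomputable def ratioDefect (α β : ℂ) (k : ℕ) : ℂ :=
  k * (β - α) / (k - 1 + α)

/-- The ratios of consecutive terms of `backwardCoeff`. -/
noncomputable def backwardRatio (α β : ℂ) (n j : ℕ) : ℂ :=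
  ((n - 1 - j : ℕ) + ratioDefect α β (n - 1 - j)) / n

lemma exists_norm_ratioDefect_le (α β : ℂ) : ∃ A : ℝ, 0 ≤ A ∧ ∀ k, ‖ratioDefect α β k‖ ≤ A := by
  have h := (tendsto_natCast_div_natCast_add (α - 1)).mul_const (β - α)
  obtain ⟨A, hA⟩ := (Metric.isBounded_range_of_tendsto _ h).exists_norm_le
  have h1 : ∀ k, ‖ratioDefect α β k‖ ≤ A := fun k => by
    have := hA _ (Set.mem_range_self k)
    rw [ratioDefect, mul_div_right_comm, show (k : ℂ) - 1 + α = k + (α - 1) by ring]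
    exact this
  exact ⟨A, (norm_nonneg _).trans (h1 0), h1⟩

lemma backwardCoeff_succ {α : ℂ} (hα : ∀ m : ℕ, α ≠ -(m : ℂ)) (β : ℂ) {n : ℕ} (hn : 0 < n) (j : ℕ) :
    backwardCoeff α β n (j + 1) = backwardRatio α β n j * backwardCoeff α β n j := by
  have hn' : (n : ℂ) ≠ 0 := by exact_mod_cast hn.ne'
  rcases lt_or_ge (j + 1) n with h | h
  · obtain ⟨k, hk⟩ : ∃ k, n - 1 - j = k + 1 := ⟨n - 1 - j - 1, by omega⟩
    have hk2 : n - 1 - (j + 1) = k := by omega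
    have h0 := natCast_add_ne_zero hα k
    have h1 := coeff_succ β h0
    rw [backwardCoeff, backwardCoeff, if_pos h, if_pos (by omega), hk2, backwardRatio, hk,
      ratioDefect, Nat.cast_add, Nat.cast_one, show (k : ℂ) + 1 - 1 + α = k + α by ring]
    have h2 : coeff α β k = (k + 1 + (k + 1) * (β - α) / (k + α)) * coeff α β (k + 1) := by
      field_simp
      linear_combination -h1
    rw [h2, pow_succ]
    field_simp
  -- Past the last coefficient the truncated subtraction gives `0`, and `ratioDefect` vanishes there
  -- through its factor `k`, so the recurrence also holds across the end of the polynomial.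
  · have h1 : backwardRatio α β n j = 0 := by
      rw [backwardRatio, show n - 1 - j = 0 by omega, ratioDefect]
      simp
    rw [h1, zero_mul, backwardCoeff, if_neg (by omega)]

/-- The ratios are `(n - 1 - j + O(1)) / n`, at most `exp((A - 1 - j)/n)` in norm. Since `j < n` on
the support, the constant scale `n` suffices. -/
lemma exists_slowRecurrence_backward {α : ℂ} (hα : ∀ m : ℕ, α ≠ -(m : ℂ)) (β : ℂ) :
    ∃ B D : ℝ, ∀ᶠ n : ℕ in atTop, SlowRecurrence (backwardCoeff α β n) (backwardRatio α β n)
      (fun _ => n) n B D := by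
  obtain ⟨A, hA0, hA⟩ := exists_norm_ratioDefect_le α β
  refine ⟨1 + 2 * A, Real.exp A, ?_⟩
  filter_upwards [(tendsto_sub_atTop_nat 1).eventually (eventually_coeff_ne_zero hα β),
    eventually_ge_atTop 1] with n hc hn1
  have hn : (1 : ℝ) ≤ n := by exact_mod_cast hn1
  have hn0 : (0 : ℝ) < n := by linarith
  have hn' : (n : ℂ) ≠ 0 := by exact_mod_cast (by omega : n ≠ 0)
  have hzero : backwardCoeff α β n 0 = 1 := by
    simp [backwardCoeff, hc, (by omega : 0 < n)]
  have hsucc := backwardCoeff_succ hα β (n := n) (by omega)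
  have hk : ∀ j : ℕ, ((n - 1 - j : ℕ) : ℝ) ≤ n := fun j => by
    exact_mod_cast (by omega : n - 1 - j ≤ n)
  have hqn : ∀ j : ℕ, ‖backwardRatio α β n j‖ ≤ ((n - 1 - j : ℕ) + A) / n := by
    intro j
    rw [backwardRatio, norm_div, Complex.norm_natCast]
    gcongr
    refine (norm_add_le _ _).trans ?_
    rw [Complex.norm_natCast]
    linarith [hA (n - 1 - j)]
  refine ⟨hn, fun j => le_rfl, hzero, hsucc, fun j => ?_, fun j => ?_, fun j => ?_, fun j => ?_⟩
  · have hj : (0 : ℝ) ≤ j := Nat.cast_nonneg j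
    have h1 : backwardRatio α β n j - 1
        = ((((n - 1 - j : ℕ) : ℝ) - n : ℝ) + ratioDefect α β (n - 1 - j)) / n := by
      rw [backwardRatio]
      push_cast
      field_simp
      ring
    have h2 : |((n - 1 - j : ℕ) : ℝ) - n| ≤ j + 1 := by
      rw [abs_sub_comm, abs_of_nonneg (by linarith [hk j])]
      have : (n : ℝ) ≤ (n - 1 - j : ℕ) + (j + 1) := by
        exact_mod_cast (by omega : n ≤ (n - 1 - j) + (j + 1))
      linarith
    rw [h1, norm_div, Complex.norm_natCast]
    gcongr
    refine (norm_add_le _ _).trans ?_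
    rw [Complex.norm_real, Real.norm_eq_abs]
    nlinarith [hA (n - 1 - j)]
  · have h1 : backwardRatio α β n (j + 1) - backwardRatio α β n j
        = ((((n - 1 - (j + 1) : ℕ) : ℝ) - ((n - 1 - j : ℕ) : ℝ) : ℝ)
          + ratioDefect α β (n - 1 - (j + 1)) - ratioDefect α β (n - 1 - j)) / n := by
      rw [backwardRatio, backwardRatio]
      push_cast
      field_simp
      ring
    have h2 : |((n - 1 - (j + 1) : ℕ) : ℝ) - ((n - 1 - j : ℕ) : ℝ)| ≤ 1 := by
      have h3 : ((n - 1 - (j + 1) : ℕ) : ℝ) ≤ (n - 1 - j : ℕ) := by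
        exact_mod_cast (by omega : n - 1 - (j + 1) ≤ n - 1 - j)
      have h4 : ((n - 1 - j : ℕ) : ℝ) ≤ (n - 1 - (j + 1) : ℕ) + 1 := by
        exact_mod_cast (by omega : n - 1 - j ≤ n - 1 - (j + 1) + 1)
      rw [abs_le]
      constructor <;> linarith
    rw [h1, norm_div, Complex.norm_natCast]
    gcongr
    refine (norm_sub_le _ _).trans ?_
    have h3 := norm_add_le (((((n - 1 - (j + 1) : ℕ) : ℝ) - ((n - 1 - j : ℕ) : ℝ) : ℝ)) : ℂ)
      (ratioDefect α β (n - 1 - (j + 1)))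
    rw [Complex.norm_real, Real.norm_eq_abs] at h3
    linarith [hA (n - 1 - (j + 1)), hA (n - 1 - j)]
  · refine (hqn j).trans ?_
    rw [div_le_iff₀ hn0]
    nlinarith [hk j]
  · have h1 : ∀ j : ℕ, ‖backwardCoeff α β n j‖
        ≤ Real.exp (A * j / n - (j : ℝ) ^ 2 / (2 * n)) := by
      intro j
      induction j with
      | zero => simp [hzero]
      | succ j ih =>
        rcases lt_or_ge (j + 1) n with h | h
        · have h2 : ((n - 1 - j : ℕ) : ℝ) = n - 1 - j := by
            rw [Nat.cast_sub (by omega), Nat.cast_sub (by omega), Nat.cast_one]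
          have h3 : ‖backwardRatio α β n j‖ ≤ Real.exp ((A - 1 - j) / n) := by
            refine (hqn j).trans (le_trans (le_of_eq ?_) (Real.add_one_le_exp _))
            rw [h2]
            field_simp
            ring
          rw [hsucc, norm_mul]
          calc _ ≤ Real.exp ((A - 1 - j) / n) * Real.exp (A * j / n - (j : ℝ) ^ 2 / (2 * n)) := by
                gcongr
            _ ≤ _ := by
                rw [← Real.exp_add, Real.exp_le_exp]
                push_cast
                have h5 : A * (j + 1) / n - ((j : ℝ) + 1) ^ 2 / (2 * n)
                    = (A - 1 - j) / n + (A * j / n - (j : ℝ) ^ 2 / (2 * n)) + 1 / (2 * n) := by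
                  field_simp
                  ring
                have h6 : 0 ≤ 1 / (2 * (n : ℝ)) := by positivity
                linarith
        · rw [backwardCoeff, if_neg (by omega), norm_zero]
          positivity
    rcases lt_or_ge j n with h | h
    · refine (h1 j).trans ?_
      rw [← Real.exp_add, Real.exp_le_exp]
      have h2 : A * j / n ≤ A := by
        rw [div_le_iff₀ hn0]
        gcongr
      have h3 : (j : ℝ) ^ 2 / (4 * n) ≤ (j : ℝ) ^ 2 / (2 * n) := by
        gcongr
        norm_num
      linarith
    · rw [backwardCoeff, if_neg (by omega), norm_zero]
      positivity

lemma summable_backwardCoeff (α β : ℂ) (n : ℕ) : Summable (backwardCoeff α β n) := by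
  refine summable_of_hasFiniteSupport ((Set.finite_lt_nat n).subset fun j hj => ?_)
  by_contra h
  exact hj (if_neg h)

/-- The partial sum in terms of the reversed coefficients. -/
lemma partialSum_eq_tsum_backwardCoeff {α β : ℂ} {n : ℕ} (hn : 0 < n)
    (hc : coeff α β (n - 1) ≠ 0) {z : ℂ} (hz : z ≠ 0) :
    ∑ k ∈ Finset.range (n - 1 + 1), coeff α β k * (n * z) ^ k
      = coeff α β (n - 1) * (n * z) ^ (n - 1) * ∑' j, backwardCoeff α β n j * (z⁻¹) ^ j := by
  have hn' : (n : ℂ) ≠ 0 := by exact_mod_cast hn.ne'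
  rw [Nat.sub_add_cancel hn, tsum_eq_sum (s := Finset.range n), ← Finset.sum_range_reflect,
    Finset.mul_sum]
  · refine Finset.sum_congr rfl fun j hj => ?_
    have hj' := Finset.mem_range.1 hj
    rw [backwardCoeff, if_pos hj']
    have h1 : ((n : ℂ) * z) ^ (n - 1) = (n * z) ^ (n - 1 - j) * (n * z) ^ j := by
      rw [← pow_add]
      congr 1
      omega
    rw [h1, mul_pow (n : ℂ) z j, inv_pow]
    have h2 := pow_ne_zero j hn'
    have h3 := pow_ne_zero j hz
    field_simp
  · intro j hj
    rw [backwardCoeff, if_neg (by simpa using hj), zero_mul]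

/-- The tail of the series in terms of the forward coefficients. -/
lemma series_sub_partialSum_eq {α β : ℂ} {n : ℕ} (hn : 0 < n) (hc : coeff α β n ≠ 0) (z : ℂ) :
    series α β (n * z) - ∑ k ∈ Finset.range (n - 1 + 1), coeff α β k * (n * z) ^ k
      = coeff α β n * (n * z) ^ n * ∑' j, forwardCoeff α β n j * z ^ j := by
  rw [Nat.sub_add_cancel hn, series, ← (summable_coeff_mul_pow α β (n * z)).sum_add_tsum_nat_add n,
    add_sub_cancel_left, ← tsum_mul_left]
  refine tsum_congr fun j => ?_
  rw [forwardCoeff, pow_add, mul_pow _ _ j, add_comm j n]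
  field_simp

/-! ### Scaled limits of the series and of the partial sums -/

section

/-- The polynomial `Γ(α) p_{n-1}[𝐌]`. -/
noncomputable def gammaPartialSum (α β : ℂ) (n : ℕ) (z : ℂ) : ℂ :=
  ∑ k ∈ Finset.range (n - 1 + 1), coeff α β k * z ^ k

lemma tendsto_stirling_inv :
    Tendsto (fun n : ℕ => (n : ℂ) ^ n * Complex.exp (-n) * (Real.sqrt n : ℂ) / n.factorial) atTop
      (𝓝 (Real.sqrt (2 * Real.pi) : ℂ)⁻¹) := by
  have h1 : Tendsto (fun n : ℕ => (Stirling.stirlingSeq n * Real.sqrt 2)⁻¹) atTop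
      (𝓝 (Real.sqrt (2 * Real.pi))⁻¹) := by
    rw [mul_comm 2, Real.sqrt_mul Real.pi_pos.le]
    exact (Stirling.tendsto_stirlingSeq_sqrt_pi.mul_const _).inv₀ (by positivity)
  have h2 := (Complex.continuous_ofReal.tendsto _).comp h1
  rw [Complex.ofReal_inv] at h2
  refine h2.congr' ?_
  filter_upwards [eventually_gt_atTop 0] with n hn
  have hn0 : (0 : ℝ) < n := by exact_mod_cast hn
  have h3 : (Stirling.stirlingSeq n * Real.sqrt 2)⁻¹
      = (n : ℝ) ^ n * Real.exp (-n) * Real.sqrt n / n.factorial := by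
    have h4 : (Real.sqrt 2) ≠ 0 := by positivity
    have h5 : (Real.sqrt n) ≠ 0 := by positivity
    have h6 : (n.factorial : ℝ) ≠ 0 := by positivity
    rw [Stirling.stirlingSeq, Real.sqrt_mul zero_le_two, div_pow, ← Real.exp_nat_mul, mul_one,
      Real.exp_neg]
    field_simp
  simp only [Function.comp_apply, h3]
  push_cast
  rfl

/-- The size of the `n`-th term of the series relative to its sum. -/
lemma tendsto_coeff_scaled (α β : ℂ) :
    Tendsto (fun n : ℕ => coeff α β n * (n : ℂ) ^ n * Complex.exp (-n) * (Real.sqrt n : ℂ)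
      / (n : ℂ) ^ (α - β)) atTop (𝓝 (Real.sqrt (2 * Real.pi) : ℂ)⁻¹) := by
  have h := (tendsto_gammaRatio α β).mul tendsto_stirling_inv
  rw [one_mul] at h
  refine h.congr fun n => ?_
  rw [coeff_eq_gammaRatio_div]
  ring

/-- Separates the Stirling constant from the factor `(ζ e^{1-ζ})^n / √n`, which alone depends on `ζ`
and decides between series and tail. -/
lemma coeff_mul_pow_div (α β : ℂ) {n : ℕ} (hn : 0 < n) (ζ : ℂ) :
    coeff α β n * (n * ζ) ^ n * Complex.exp (-(n * ζ)) / (n : ℂ) ^ (α - β)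
      = (coeff α β n * (n : ℂ) ^ n * Complex.exp (-n) * (Real.sqrt n : ℂ) / (n : ℂ) ^ (α - β))
        * ((ζ * Complex.exp (1 - ζ)) ^ n / (Real.sqrt n : ℂ)) := by
  have hn0 : (0 : ℝ) < n := by exact_mod_cast hn
  have h1 : (Real.sqrt n : ℂ) ≠ 0 := by
    exact_mod_cast (Real.sqrt_pos.2 hn0).ne'
  have h2 : Complex.exp (-(n * ζ)) = Complex.exp (-n) * Complex.exp (1 - ζ) ^ n := by
    rw [← Complex.exp_nat_mul, ← Complex.exp_add]
    congr 1
    ring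
  rw [h2, mul_pow, mul_pow]
  field_simp

variable {ι : Type*} {l : Filter ι} {k : ι → ℕ} {ζ : ι → ℂ} {ξ : ℂ}

lemma tendsto_series_scaled {α : ℂ} (hα : ∀ m : ℕ, α ≠ -(m : ℂ)) (β : ℂ) (hk : Tendsto k l atTop)
    (hζ : Tendsto ζ l (𝓝 ξ)) (hξ : 0 < ξ.re) :
    Tendsto (fun i => series α β (k i * ζ i) * Complex.exp (-(k i * ζ i)) / (k i : ℂ) ^ (α - β)) l
      (𝓝 (ξ ^ (α - β))) := by
  have h := (hasLeadingAsymptotics hα β ξ hξ).comp (hk.prodMk hζ)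
  simp only [Function.comp_def] at h
  exact h

/-- Series minus tail. The limit `Y` of the normalized tail is left as a parameter: it is `0` where
`|ξ e^{1-ξ}| < 1` in the closed unit disc, an exponential near the arc, and a Gaussian integral near
`1`. -/
lemma tendsto_gammaPartialSum_scaled {α : ℂ} (hα : ∀ m : ℕ, α ≠ -(m : ℂ)) (β : ℂ)
    (hk : Tendsto k l atTop) (hζ : Tendsto ζ l (𝓝 ξ)) (hξ : 0 < ξ.re) {Y : ℂ}
    (hY : Tendsto (fun i => (ζ i * Complex.exp (1 - ζ i)) ^ k i / (Real.sqrt (k i) : ℂ)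
      * ∑' j, forwardCoeff α β (k i) j * ζ i ^ j) l (𝓝 Y)) :
    Tendsto (fun i => gammaPartialSum α β (k i) (k i * ζ i) * Complex.exp (-(k i * ζ i))
      / (k i : ℂ) ^ (α - β)) l (𝓝 (ξ ^ (α - β) - (Real.sqrt (2 * Real.pi) : ℂ)⁻¹ * Y)) := by
  refine ((tendsto_series_scaled hα β hk hζ hξ).sub
    (((tendsto_coeff_scaled α β).comp hk).mul hY)).congr' ?_
  filter_upwards [hk.eventually (eventually_gt_atTop 0),
    hk.eventually (eventually_coeff_ne_zero hα β)] with i hi hc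
  have h1 := series_sub_partialSum_eq hi hc (ζ i)
  have h2 := coeff_mul_pow_div α β hi (ζ i)
  rw [Function.comp_apply, ← mul_assoc, ← h2, gammaPartialSum, sub_eq_iff_eq_add, ← sub_eq_iff_eq_add',
    ← sub_div, ← sub_mul, h1]
  ring

lemma cpow_ne_zero_of_re_pos (hξ : 0 < ξ.re) (c : ℂ) : ξ ^ c ≠ 0 := by
  have : ξ ≠ 0 := by
    rintro rfl
    simp at hξ
  simp [Complex.cpow_eq_zero_iff, this]

lemma M_eq (α β z : ℂ) : M α β z = 1 / Complex.Gamma α * series α β z := rfl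

lemma partialSum_eq (α β : ℂ) (n : ℕ) (z : ℂ) :
    partialSum α β (n - 1) z = 1 / Complex.Gamma α * gammaPartialSum α β n z := rfl

lemma tendsto_partialSum_div {α : ℂ} (hα : ∀ m : ℕ, α ≠ -(m : ℂ)) (β : ℂ)
    (hk : Tendsto k l atTop) (hζ : Tendsto ζ l (𝓝 ξ)) (hξ : 0 < ξ.re) {Y : ℂ}
    (hY : Tendsto (fun i => (ζ i * Complex.exp (1 - ζ i)) ^ k i / (Real.sqrt (k i) : ℂ)
      * ∑' j, forwardCoeff α β (k i) j * ζ i ^ j) l (𝓝 Y)) :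
    Tendsto (fun i => partialSum α β (k i - 1) (k i * ζ i) / M α β (k i * ζ i)) l
      (𝓝 (1 - (Real.sqrt (2 * Real.pi) : ℂ)⁻¹ * Y / ξ ^ (α - β))) := by
  have h0 := cpow_ne_zero_of_re_pos hξ (α - β)
  have h := (tendsto_gammaPartialSum_scaled hα β hk hζ hξ hY).div (tendsto_series_scaled hα β hk hζ hξ) h0
  rw [sub_div, div_self h0] at h
  refine h.congr' ?_
  filter_upwards [hk.eventually (eventually_gt_atTop 0)] with i hi
  have hi' : (k i : ℂ) ≠ 0 := by exact_mod_cast hi.ne'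
  have h5 : (k i : ℂ) ^ (α - β) ≠ 0 := by simp [Complex.cpow_eq_zero_iff, hi']
  have hG : 1 / Complex.Gamma α ≠ 0 := one_div_ne_zero (Complex.Gamma_ne_zero hα)
  rw [Pi.div_apply, div_div_div_cancel_right₀ h5, mul_div_mul_right _ _ (Complex.exp_ne_zero _),
    M_eq, partialSum_eq, mul_div_mul_left _ _ hG]

lemma eventually_M_ne_zero {α : ℂ} (hα : ∀ m : ℕ, α ≠ -(m : ℂ)) (β : ℂ)
    (hk : Tendsto k l atTop) (hζ : Tendsto ζ l (𝓝 ξ)) (hξ : 0 < ξ.re) :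
    ∀ᶠ i in l, M α β (k i * ζ i) ≠ 0 := by
  filter_upwards [(tendsto_series_scaled hα β hk hζ hξ).eventually_ne
    (cpow_ne_zero_of_re_pos hξ (α - β))] with i hi h
  rw [M_eq] at h
  have := (mul_eq_zero.1 h).resolve_left (one_div_ne_zero (Complex.Gamma_ne_zero hα))
  exact hi (by simp [this])

/-! ### Uniformity on compact sets from joint convergence -/

lemma continuousOn_of_forall_tendsto {K : Set ℂ} {F : ℕ → ℂ → ℂ} {G : ℂ → ℂ}
    (h : ∀ w₀ ∈ K, Tendsto (fun p : ℕ × ℂ => F p.1 p.2) (atTop ×ˢ 𝓝[K] w₀) (𝓝 (G w₀))) :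
    ContinuousOn G K := by
  intro w₀ hw₀
  refine Metric.tendsto_nhds.2 fun ε hε => ?_
  obtain ⟨pa, hpa, pb, hpb, hab⟩ :=
    eventually_prod_iff.1 (Metric.tendsto_nhds.1 (h w₀ hw₀) (ε / 2) (half_pos hε))
  filter_upwards [hpb, self_mem_nhdsWithin] with w hw hwK
  have h1 : Tendsto (fun n => F n w) atTop (𝓝 (G w)) :=
    (h w hwK).comp (tendsto_id.prodMk
      (tendsto_const_pure.mono_right (pure_le_nhdsWithin hwK)))
  have h2 : dist (G w) (G w₀) ≤ ε / 2 := by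
    refine le_of_tendsto (h1.dist tendsto_const_nhds) ?_
    filter_upwards [hpa] with n hn using (hab hn hw).le
  linarith

/-- Joint convergence in `n` and `w` forces a continuous limit, and then local uniformity. Every
scaling limit can thus be proved along a single filter. -/
lemma tendstoUniformlyOn_of_forall_tendsto {K : Set ℂ} (hK : IsCompact K) {F : ℕ → ℂ → ℂ}
    {G : ℂ → ℂ}
    (h : ∀ w₀ ∈ K, Tendsto (fun p : ℕ × ℂ => F p.1 p.2) (atTop ×ˢ 𝓝[K] w₀) (𝓝 (G w₀))) :
    TendstoUniformlyOn F G atTop K := by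
  rw [← tendstoLocallyUniformlyOn_iff_tendstoUniformlyOn_of_compact hK,
    tendstoLocallyUniformlyOn_iff_forall_tendsto]
  intro w hw
  exact (((continuousOn_of_forall_tendsto h w hw).tendsto.comp tendsto_snd).prodMk_nhds
    (h w hw)).mono_right (nhds_le_uniformity _)

lemma eventually_forall_of_forall_eventually {K : Set ℂ} (hK : IsCompact K) {P : ℕ → ℂ → Prop}
    (h : ∀ w₀ ∈ K, ∀ᶠ p : ℕ × ℂ in atTop ×ˢ 𝓝[K] w₀, P p.1 p.2) :
    ∀ᶠ n in atTop, ∀ w ∈ K, P n w := by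
  refine hK.induction_on (p := fun s => ∀ᶠ n in atTop, ∀ w ∈ s, P n w) (by simp) ?_ ?_ ?_
  · intro s t hst ht
    filter_upwards [ht] with n hn w hw using hn w (hst hw)
  · intro s t hs ht
    filter_upwards [hs, ht] with n h1 h2 w hw
    exact hw.elim (h1 w) (h2 w)
  · intro w hw
    obtain ⟨pa, hpa, pb, hpb, hab⟩ := eventually_prod_iff.1 (h w hw)
    exact ⟨{x | pb x}, hpb, by filter_upwards [hpa] with n hn x hx using hab hn hx⟩

end

/-! ### Limits near the arc -/

section

variable {ι : Type*} {l : Filter ι} {k : ι → ℕ}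

lemma tendsto_sqrt_natCast_atTop : Tendsto (fun n : ℕ => Real.sqrt n) atTop atTop :=
  Real.tendsto_sqrt_atTop.comp tendsto_natCast_atTop_atTop

lemma tendsto_ofReal_inv_sqrt :
    Tendsto (fun n : ℕ => ((Real.sqrt n : ℂ))⁻¹) atTop (𝓝 0) := by
  have h := (Complex.continuous_ofReal.tendsto _).comp tendsto_sqrt_natCast_atTop.inv_tendsto_atTop
  simpa [Function.comp_def] using h

lemma ofReal_sqrt_mul_self (n : ℕ) : (Real.sqrt n : ℂ) * (Real.sqrt n : ℂ) = n := by
  rw [← Complex.ofReal_mul, Real.mul_self_sqrt (Nat.cast_nonneg n), Complex.ofReal_natCast]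

lemma ofReal_sqrt_ne_zero {n : ℕ} (hn : 0 < n) : (Real.sqrt n : ℂ) ≠ 0 := by
  have : (0 : ℝ) < n := by exact_mod_cast hn
  exact_mod_cast (Real.sqrt_pos.2 this).ne'

lemma tendsto_zero_of_sqrt_mul {δ : ι → ℂ} (hk : Tendsto k l atTop) {c : ℂ}
    (hδ : Tendsto (fun i => (Real.sqrt (k i) : ℂ) * δ i) l (𝓝 c)) : Tendsto δ l (𝓝 0) := by
  have h := (tendsto_ofReal_inv_sqrt.comp hk).mul hδ
  rw [zero_mul] at h
  refine h.congr' ?_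
  filter_upwards [hk.eventually (eventually_gt_atTop 0)] with i hi
  rw [Function.comp_apply, inv_mul_cancel_left₀ (ofReal_sqrt_ne_zero hi)]

lemma tendsto_mul_log_one_add_sub {δ : ι → ℂ} (hk : Tendsto k l atTop)
    (hδ : Tendsto (fun i => (Real.sqrt (k i) : ℂ) * δ i) l (𝓝 0)) :
    Tendsto (fun i => (k i : ℂ) * (Complex.log (1 + δ i) - δ i)) l (𝓝 0) := by
  have h0 := tendsto_zero_of_sqrt_mul hk hδ
  rw [tendsto_zero_iff_norm_tendsto_zero]
  have h2 := (hδ.norm.pow 2)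
  rw [norm_zero, zero_pow two_ne_zero] at h2
  refine squeeze_zero' (Eventually.of_forall fun i => norm_nonneg _) ?_ h2
  filter_upwards [h0.norm.eventually_le_const (show ‖(0 : ℂ)‖ < 1 / 2 by simp)] with i hi
  have h3 := Complex.norm_log_one_add_sub_self_le (z := δ i) (by linarith)
  have h4 : (1 - ‖δ i‖)⁻¹ ≤ 2 := by
    rw [inv_le_comm₀ (by linarith) two_pos]
    linarith
  rw [norm_mul, norm_mul, mul_pow, Complex.norm_natCast, Complex.norm_real,
    Real.norm_of_nonneg (Real.sqrt_nonneg _), Real.sq_sqrt (Nat.cast_nonneg _)]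
  gcongr
  refine h3.trans ?_
  have := mul_le_mul_of_nonneg_left h4 (sq_nonneg ‖δ i‖)
  linarith

/-- On the unit circle the curve equation forces `Re ξ = 1`, hence `ξ = 1`. Strictness puts the
points `arcPoint` eventually in the disc where the tail sum is controlled. -/
lemma szegoCurve_norm_lt_one {ξ : ℂ} (hξ : ξ ∈ szegoCurve) (h1 : ξ ≠ 1) : ‖ξ‖ < 1 := by
  obtain ⟨h2, h3, -⟩ := hξ
  refine lt_of_le_of_ne h3 fun h => h1 ?_
  rw [norm_mul, h, one_mul, Complex.norm_exp, Real.exp_eq_one_iff] at h2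
  have hre : ξ.re = 1 := by
    simp at h2
    linarith
  have h4 := Complex.sq_norm_sub_sq_re ξ
  rw [h, hre] at h4
  have h5 : ξ.im = 0 := by
    have : ξ.im ^ 2 = 0 := by linarith
    exact pow_eq_zero_iff two_ne_zero |>.1 this
  exact Complex.ext hre h5

lemma ne_zero_of_mem_szegoCurve {ξ : ℂ} (hξ : ξ ∈ szegoCurve) : ξ ≠ 0 := by
  rintro rfl
  simpa using hξ.2.2

lemma mul_exp_one_sub_eq {ξ : ℂ} (hξ : ξ ∈ szegoCurve) :
    ξ * Complex.exp (1 - ξ) = Complex.exp (-(Complex.I * tau ξ)) := by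
  have h0 := ne_zero_of_mem_szegoCurve hξ
  have h1 : ξ * Complex.exp (1 - ξ) = Complex.exp (Complex.log ξ + (1 - ξ)) := by
    rw [Complex.exp_add, Complex.exp_log h0]
  have h2 := hξ.1
  rw [h1, Complex.norm_exp, Real.exp_eq_one_iff] at h2
  rw [h1]
  congr 1
  apply Complex.ext
  · simpa using h2
  · simp [tau]
    ring

lemma exp_tauSeq (ξ : ℂ) (n : ℕ) :
    Complex.exp (Complex.I * tauSeq ξ n) = Complex.exp (Complex.I * tau ξ) ^ n := by
  rw [← Complex.exp_nat_mul, Complex.exp_eq_exp_iff_exists_int]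
  refine ⟨-toIocDiv Real.two_pi_pos (-Real.pi) (tau ξ * n), ?_⟩
  have h := congrArg (fun x : ℝ => (x : ℂ))
    (toIocMod_add_toIocDiv_zsmul Real.two_pi_pos (-Real.pi) (tau ξ * n))
  simp only [zsmul_eq_mul] at h
  push_cast at h ⊢
  rw [tauSeq]
  linear_combination Complex.I * h

/-- The relative displacement of `arcPoint ξ n w` from `ξ`. -/
noncomputable def arcShift (ξ : ℂ) (n : ℕ) (w : ℂ) : ℂ :=
  (Real.log n : ℂ) / (2 * (1 - ξ) * n) - (w - Complex.I * (tauSeq ξ n : ℂ)) / ((1 - ξ) * n)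

lemma arcPoint_eq (ξ : ℂ) (n : ℕ) (w : ℂ) : arcPoint ξ n w = ξ * (1 + arcShift ξ n w) := by
  rw [arcPoint, arcShift, add_sub_assoc]

lemma abs_tauSeq_le (ξ : ℂ) (n : ℕ) : |tauSeq ξ n| ≤ Real.pi := by
  have h : tauSeq ξ n ∈ Set.Ioc (-Real.pi) (-Real.pi + 2 * Real.pi) :=
    toIocMod_mem_Ioc Real.two_pi_pos (-Real.pi) (tau ξ * n)
  rw [abs_le]
  exact ⟨h.1.le, by linarith [h.2]⟩

lemma tendsto_log_div_sqrt :
    Tendsto (fun n : ℕ => (Real.log n : ℂ) * (Real.sqrt n : ℂ)⁻¹) atTop (𝓝 0) := by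
  have h := (isLittleO_log_rpow_atTop (r := 1 / 2) (by norm_num)).tendsto_div_nhds_zero
  have h2 := (Complex.continuous_ofReal.tendsto _).comp (h.comp tendsto_natCast_atTop_atTop)
  rw [Complex.ofReal_zero] at h2
  refine h2.congr fun n => ?_
  simp [Function.comp_apply, Real.sqrt_eq_rpow, div_eq_mul_inv]

/-- Because `τ_n` is bounded, the shift is `O(log n / n)`; being `o(n^{-1/2})`, it contributes only
its linear term to an `n`-th power. -/
lemma tendsto_sqrt_mul_arcShift (ξ : ℂ) (hk : Tendsto k l atTop) {w : ι → ℂ} {w₀ : ℂ}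
    (hw : Tendsto w l (𝓝 w₀)) :
    Tendsto (fun i => (Real.sqrt (k i) : ℂ) * arcShift ξ (k i) (w i)) l (𝓝 0) := by
  have h1 := (tendsto_log_div_sqrt.comp hk).const_mul (2 * (1 - ξ))⁻¹
  have h2 : Tendsto (fun i => (Real.sqrt (k i) : ℂ)⁻¹ * (w i - Complex.I * (tauSeq ξ (k i) : ℂ))) l
      (𝓝 0) := by
    rw [tendsto_zero_iff_norm_tendsto_zero]
    have h3 := ((tendsto_ofReal_inv_sqrt.comp hk).norm).mul (hw.norm.add_const Real.pi)
    rw [norm_zero, zero_mul] at h3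
    refine squeeze_zero (fun i => norm_nonneg _) (fun i => ?_) h3
    rw [norm_mul]
    gcongr
    · rfl
    · refine (norm_sub_le _ _).trans ?_
      gcongr
      rw [norm_mul, Complex.norm_I, one_mul, Complex.norm_real, Real.norm_eq_abs]
      exact abs_tauSeq_le _ _
  have h4 := h1.sub (h2.const_mul (1 - ξ)⁻¹)
  rw [mul_zero, mul_zero, sub_zero] at h4
  refine h4.congr' ?_
  filter_upwards [hk.eventually (eventually_gt_atTop 0)] with i hi
  have h5 := ofReal_sqrt_ne_zero hi
  rw [Function.comp_apply, arcShift, ← ofReal_sqrt_mul_self (k i)]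
  field_simp

lemma tendsto_arcPoint (ξ : ℂ) (hk : Tendsto k l atTop) {w : ι → ℂ} {w₀ : ℂ}
    (hw : Tendsto w l (𝓝 w₀)) : Tendsto (fun i => arcPoint ξ (k i) (w i)) l (𝓝 ξ) := by
  have h := ((tendsto_zero_of_sqrt_mul hk (tendsto_sqrt_mul_arcShift ξ hk hw)).const_add
    1).const_mul ξ
  rw [add_zero, mul_one] at h
  exact h.congr fun i => (arcPoint_eq _ _ _).symm

/-- The definition of `arcPoint` is tuned to this: `i τ_n` cancels the rotation `(ξ e^{1-ξ})^n =
e^{-iτn}`, the term `(log n)/2` produces the `√n` of Stirling's formula, and `-w` is what remains.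
-/
lemma tendsto_arcPoint_pow {ξ : ℂ} (hξ : ξ ∈ szegoCurve) (hξ1 : ξ ≠ 1) (hk : Tendsto k l atTop)
    {w : ι → ℂ} {w₀ : ℂ} (hw : Tendsto w l (𝓝 w₀)) :
    Tendsto (fun i => (arcPoint ξ (k i) (w i) * Complex.exp (1 - arcPoint ξ (k i) (w i))) ^ k i
      / (Real.sqrt (k i) : ℂ)) l (𝓝 (Complex.exp (-w₀))) := by
  have hs := tendsto_sqrt_mul_arcShift ξ hk hw
  have h1 := (Complex.continuous_exp.tendsto _).comp
    (hw.neg.add (tendsto_mul_log_one_add_sub hk hs))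
  rw [add_zero] at h1
  refine h1.congr' ?_
  have hsm := (tendsto_zero_of_sqrt_mul hk hs).norm.eventually_lt_const
    (show ‖(0 : ℂ)‖ < 1 by simp)
  filter_upwards [hk.eventually (eventually_gt_atTop 0), hsm] with i hi hsi
  have hn0 : (0 : ℝ) < k i := by exact_mod_cast hi
  have hn' : (k i : ℂ) ≠ 0 := by exact_mod_cast hi.ne'
  have hξ' : 1 - ξ ≠ 0 := sub_ne_zero.2 hξ1.symm
  have h5 := ofReal_sqrt_ne_zero hi
  rw [Function.comp_apply, arcPoint_eq]
  set δ := arcShift ξ (k i) (w i) with hδ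
  have h6 : 1 + δ ≠ 0 := by
    intro h
    have : δ = -1 := by linear_combination h
    rw [this] at hsi
    simp at hsi
  have h7 : (k i : ℂ) * ((1 - ξ) * δ) = (Real.log (k i) : ℂ) / 2 - w i
      + Complex.I * tauSeq ξ (k i) := by
    rw [hδ, arcShift]
    field_simp
    ring
  have h8 : Complex.exp ((Real.log (k i) : ℂ) / 2) = (Real.sqrt (k i) : ℂ) := by
    rw [← Real.exp_log (Real.sqrt_pos.2 hn0), Real.log_sqrt hn0.le]
    push_cast
    rfl
  have h9 : ξ * (1 + δ) * Complex.exp (1 - ξ * (1 + δ))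
      = ξ * Complex.exp (1 - ξ) * Complex.exp ((1 - ξ) * δ + (Complex.log (1 + δ) - δ)) := by
    rw [show (1 - ξ) * δ + (Complex.log (1 + δ) - δ) = Complex.log (1 + δ) + -(ξ * δ) by ring,
      Complex.exp_add, Complex.exp_log h6, show 1 - ξ * (1 + δ) = (1 - ξ) + -(ξ * δ) by ring,
      Complex.exp_add]
    ring
  have h10 : Complex.exp (-(Complex.I * tau ξ)) ^ k i * Complex.exp (Complex.I * tauSeq ξ (k i))
      = 1 := by
    rw [exp_tauSeq, ← mul_pow, ← Complex.exp_add]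
    simp
  rw [h9, mul_exp_one_sub_eq hξ, mul_pow, ← Complex.exp_nat_mul _ (k i), ← Complex.exp_nat_mul _ (k i),
    mul_add, h7, show (Real.log (k i) : ℂ) / 2 - w i + Complex.I * tauSeq ξ (k i)
      + k i * (Complex.log (1 + δ) - δ) = (Real.log (k i) : ℂ) / 2 + Complex.I * tauSeq ξ (k i)
      + (-w i + k i * (Complex.log (1 + δ) - δ)) by ring, Complex.exp_add _ (-w i + _),
    Complex.exp_add ((Real.log (k i) : ℂ) / 2), h8, Complex.exp_nat_mul]
  rw [eq_div_iff h5]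
  linear_combination (-(Real.sqrt (k i) : ℂ)
    * Complex.exp (-w i + k i * (Complex.log (1 + δ) - δ))) * h10

lemma tendsto_forward_sum {α : ℂ} (hα : ∀ m : ℕ, α ≠ -(m : ℂ)) (β : ℂ) (hk : Tendsto k l atTop)
    {ζ : ι → ℂ} {ξ : ℂ} (hζ : Tendsto ζ l (𝓝 ξ)) (hζ1 : ∀ᶠ i in l, ‖ζ i‖ ≤ 1) (hξ : ξ ≠ 1) :
    Tendsto (fun i => ∑' j, forwardCoeff α β (k i) j * ζ i ^ j) l (𝓝 (1 - ξ)⁻¹) := by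
  obtain ⟨B, D, h⟩ := exists_slowRecurrence_forward hα β
  exact tendsto_tsum_of_slowRecurrence h (Eventually.of_forall (summable_forwardCoeff α β)) hk hζ
    hζ1 hξ

lemma tendsto_arcPoint_main {α : ℂ} (hα : ∀ m : ℕ, α ≠ -(m : ℂ)) (β : ℂ) {ξ : ℂ}
    (hξ : ξ ∈ szegoCurve) (hξ1 : ξ ≠ 1) (hk : Tendsto k l atTop)
    {w : ι → ℂ} {w₀ : ℂ} (hw : Tendsto w l (𝓝 w₀)) :
    Tendsto (fun i => (arcPoint ξ (k i) (w i) * Complex.exp (1 - arcPoint ξ (k i) (w i))) ^ k i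
      / (Real.sqrt (k i) : ℂ) * ∑' j, forwardCoeff α β (k i) j * arcPoint ξ (k i) (w i) ^ j) l
      (𝓝 (Complex.exp (-w₀) * (1 - ξ)⁻¹)) := by
  have h := tendsto_arcPoint ξ hk hw
  exact (tendsto_arcPoint_pow hξ hξ1 hk hw).mul (tendsto_forward_sum hα β hk h
    (h.norm.eventually_le_const (szegoCurve_norm_lt_one hξ hξ1)) hξ1)

/-- The limit on the scale `log n / n` at the points of the Szegő curve other than `1`. -/
theorem limit_near_arc {α : ℂ} (hα : ∀ m : ℕ, α ≠ -(m : ℂ)) (β : ℂ) {ξ : ℂ}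
    (hξ : ξ ∈ szegoCurve) (hξ1 : ξ ≠ 1) {K : Set ℂ} (hK : IsCompact K) :
    (∀ᶠ n : ℕ in atTop, ∀ w ∈ K, M α β ((n : ℂ) * arcPoint ξ n w) ≠ 0) ∧
      TendstoUniformlyOn
        (fun (n : ℕ) (w : ℂ) =>
          partialSum α β (n - 1) ((n : ℂ) * arcPoint ξ n w) / M α β ((n : ℂ) * arcPoint ξ n w))
        (fun w => 1 - Complex.exp (-w)
          / (ξ ^ (α - β) * (1 - ξ) * (Real.sqrt (2 * Real.pi) : ℂ)))
        atTop K := by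
  have hw : ∀ w₀ : ℂ, Tendsto (Prod.snd : ℕ × ℂ → ℂ) (atTop ×ˢ 𝓝[K] w₀) (𝓝 w₀) := fun w₀ =>
    tendsto_snd.mono_right nhdsWithin_le_nhds
  have hk : ∀ w₀ : ℂ, Tendsto (Prod.fst : ℕ × ℂ → ℕ) (atTop ×ˢ 𝓝[K] w₀) atTop := fun w₀ =>
    tendsto_fst
  constructor
  · exact eventually_forall_of_forall_eventually hK fun w₀ _ =>
      eventually_M_ne_zero hα β (hk w₀) (tendsto_arcPoint ξ (hk w₀) (hw w₀)) hξ.2.2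
  · refine tendstoUniformlyOn_of_forall_tendsto hK fun w₀ _ => ?_
    have h := tendsto_partialSum_div hα β (hk w₀) (tendsto_arcPoint ξ (hk w₀) (hw w₀)) hξ.2.2
      (tendsto_arcPoint_main hα β hξ hξ1 (hk w₀) (hw w₀))
    convert! h using 3
    field_simp

end

/-! ### Sums as integrals; Gaussian limit of the tail coefficients -/

section

variable {ι : Type*} {l : Filter ι} {k : ι → ℕ}

lemma setIntegral_floor (a : ℕ → ℂ) (j : ℕ) :
    ∫ x in Set.Ico (j : ℝ) (j + 1), a ⌊x⌋₊ = a j := by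
  rw [MeasureTheory.setIntegral_congr_fun (g := fun _ => a j) measurableSet_Ico fun x hx => by
    simp only [(Nat.floor_eq_iff (le_trans (Nat.cast_nonneg j) hx.1)).2 hx]]
  simp

lemma iUnion_Ico_natCast : ⋃ j : ℕ, Set.Ico (j : ℝ) (j + 1) = Set.Ici 0 := by
  ext x
  simp only [Set.mem_iUnion, Set.mem_Ico, Set.mem_Ici]
  constructor
  · rintro ⟨j, h, -⟩
    exact (Nat.cast_nonneg j).trans h
  · intro h
    exact ⟨⌊x⌋₊, Nat.floor_le h, Nat.lt_floor_add_one x⟩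

/-- Writing a sum as the integral of a step function turns the Riemann sum at the critical point
into a case of dominated convergence. -/
lemma integral_floor_eq_tsum {a : ℕ → ℂ} (ha : Summable a) :
    ∫ x in Set.Ioi (0 : ℝ), a ⌊x⌋₊ = ∑' j, a j := by
  have hd : Pairwise (Function.onFun Disjoint fun j : ℕ => Set.Ico (j : ℝ) (j + 1)) := by
    intro i j hij
    refine Set.disjoint_left.2 fun x hx hx' => hij ?_
    rw [← (Nat.floor_eq_iff (le_trans (Nat.cast_nonneg i) hx.1)).2 hx,
      (Nat.floor_eq_iff (le_trans (Nat.cast_nonneg j) hx'.1)).2 hx']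
  have hint : MeasureTheory.IntegrableOn (fun x : ℝ => a ⌊x⌋₊)
      (⋃ j : ℕ, Set.Ico (j : ℝ) (j + 1)) := by
    refine MeasureTheory.integrableOn_iUnion_of_summable_integral_norm (fun j => ?_) ?_
    · refine (MeasureTheory.integrableOn_const (C := a j) (by simp)).congr_fun (fun x hx => ?_)
        measurableSet_Ico
      simp only [(Nat.floor_eq_iff (le_trans (Nat.cast_nonneg j) hx.1)).2 hx]
    · refine ha.norm.congr fun j => ?_
      rw [MeasureTheory.setIntegral_congr_fun (g := fun _ => ‖a j‖) measurableSet_Ico fun x hx => by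
        simp only [(Nat.floor_eq_iff (le_trans (Nat.cast_nonneg j) hx.1)).2 hx]]
      simp
  have h := MeasureTheory.hasSum_integral_iUnion (fun j => measurableSet_Ico) hd hint
  rw [iUnion_Ico_natCast, MeasureTheory.integral_Ici_eq_integral_Ioi] at h
  simp only [setIntegral_floor] at h
  exact h.tsum_eq.symm

lemma integral_floor_mul_eq_tsum_div {a : ℕ → ℂ} (ha : Summable a) {c : ℝ} (hc : 0 < c) :
    ∫ t in Set.Ioi (0 : ℝ), a ⌊t * c⌋₊ = (∑' j, a j) / c := by
  have h := MeasureTheory.integral_comp_mul_left_Ioi (fun x => a ⌊x⌋₊) 0 hc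
  rw [mul_zero, integral_floor_eq_tsum ha] at h
  simp only [mul_comm c] at h
  rw [h, Complex.real_smul, Complex.ofReal_inv, inv_mul_eq_div]

/-- `n! n ^ j / (n + j)!`. -/
noncomputable def factorialRatio (n j : ℕ) : ℝ :=
  (n.factorial : ℝ) * (n : ℝ) ^ j / (n + j).factorial

lemma factorialRatio_succ (n j : ℕ) :
    factorialRatio n (j + 1) = n / (n + j + 1) * factorialRatio n j := by
  rw [factorialRatio, factorialRatio, ← add_assoc, Nat.factorial_succ]
  push_cast
  have h1 : ((n + j).factorial : ℝ) ≠ 0 := by positivity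
  have h2 : (n : ℝ) + j + 1 ≠ 0 := by positivity
  field_simp
  ring

lemma factorialRatio_zero (n : ℕ) : factorialRatio n 0 = 1 := by
  have h1 : (n.factorial : ℝ) ≠ 0 := by positivity
  simp [factorialRatio, h1]

lemma factorialRatio_le {n : ℕ} (hn : 0 < n) (j : ℕ) :
    factorialRatio n j ≤ Real.exp (-((j : ℝ) ^ 2 / (2 * (n + j)))) := by
  induction j with
  | zero => simp [factorialRatio_zero]
  | succ j ih =>
    rw [factorialRatio_succ]
    refine le_trans ?_ (gaussian_step (by exact_mod_cast hn) j)
    gcongr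

/-- From `1 + y ≤ e^y` with `y = (j+1)/n`, each factor is at least `e^{-y}`, and the exponents add
up to a triangular number over `n`. -/
lemma le_factorialRatio {n : ℕ} (hn : 0 < n) (j : ℕ) :
    Real.exp (-((j : ℝ) * (j + 1) / (2 * n))) ≤ factorialRatio n j := by
  have hn0 : (0 : ℝ) < n := by exact_mod_cast hn
  induction j with
  | zero => simp [factorialRatio_zero]
  | succ j ih =>
    rw [factorialRatio_succ]
    have h1 : Real.exp (-((j + 1) / n)) ≤ n / (n + j + 1) := by
      rw [Real.exp_neg, inv_le_comm₀ (Real.exp_pos _) (by positivity)]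
      refine le_trans (le_of_eq ?_) (Real.add_one_le_exp _)
      field_simp
      ring
    calc Real.exp (-(((j + 1 : ℕ) : ℝ) * ((j + 1 : ℕ) + 1) / (2 * n)))
        = Real.exp (-((j + 1) / n)) * Real.exp (-((j : ℝ) * (j + 1) / (2 * n))) := by
          rw [← Real.exp_add]
          congr 1
          push_cast
          field_simp
          ring
      _ ≤ _ := by gcongr

lemma tendsto_inv_sqrt_natCast : Tendsto (fun n : ℕ => (Real.sqrt n)⁻¹) atTop (𝓝 0) :=
  tendsto_sqrt_natCast_atTop.inv_tendsto_atTop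

lemma tendsto_div_of_tendsto_div_sqrt (hk : Tendsto k l atTop) {j : ι → ℕ} {t : ℝ}
    (hj : Tendsto (fun i => (j i : ℝ) / Real.sqrt (k i)) l (𝓝 t)) :
    Tendsto (fun i => (j i : ℝ) / k i) l (𝓝 0) := by
  have h := hj.mul (tendsto_inv_sqrt_natCast.comp hk)
  rw [mul_zero] at h
  refine h.congr fun i => ?_
  rw [Function.comp_apply, ← div_eq_mul_inv, div_div, Real.mul_self_sqrt (Nat.cast_nonneg _)]

lemma tendsto_factorialRatio (hk : Tendsto k l atTop) {j : ι → ℕ} {t : ℝ}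
    (hj : Tendsto (fun i => (j i : ℝ) / Real.sqrt (k i)) l (𝓝 t)) :
    Tendsto (fun i => factorialRatio (k i) (j i)) l (𝓝 (Real.exp (-(t ^ 2 / 2)))) := by
  have h0 := tendsto_div_of_tendsto_div_sqrt hk hj
  have hpos := hk.eventually (eventually_gt_atTop 0)
  have h1 : Tendsto (fun i => Real.exp (-((j i : ℝ) * (j i + 1) / (2 * k i)))) l
      (𝓝 (Real.exp (-(t ^ 2 / 2)))) := by
    refine (Real.continuous_exp.tendsto _).comp (Tendsto.neg ?_)
    have h2 := (hj.mul (hj.add (tendsto_inv_sqrt_natCast.comp hk))).div_const 2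
    rw [add_zero, ← sq] at h2
    refine h2.congr' ?_
    filter_upwards [hpos] with i hi
    have hn0 : (0 : ℝ) < k i := by exact_mod_cast hi
    have h3 := Real.sq_sqrt hn0.le
    have h4 := (Real.sqrt_pos.2 hn0).ne'
    rw [Function.comp_apply]
    nth_rewrite 4 [← h3]
    field_simp
  have h2 : Tendsto (fun i => Real.exp (-((j i : ℝ) ^ 2 / (2 * (k i + j i))))) l
      (𝓝 (Real.exp (-(t ^ 2 / 2)))) := by
    refine (Real.continuous_exp.tendsto _).comp (Tendsto.neg ?_)
    have h2 := (hj.pow 2).div ((h0.const_add 1).const_mul 2) (by norm_num)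
    rw [add_zero, mul_one] at h2
    refine h2.congr' ?_
    filter_upwards [hpos] with i hi
    have hn0 : (0 : ℝ) < k i := by exact_mod_cast hi
    rw [Pi.div_apply, div_pow, Real.sq_sqrt hn0.le]
    field_simp
  refine tendsto_of_tendsto_of_tendsto_of_le_of_le' h1 h2 ?_ ?_
  · filter_upwards [hpos] with i hi using le_factorialRatio hi _
  · filter_upwards [hpos] with i hi using factorialRatio_le hi _

lemma forwardCoeff_eq (α β : ℂ) (n j : ℕ) :
    forwardCoeff α β n j = gammaRatio α β (n + j) / gammaRatio α β n * factorialRatio n j := by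
  rw [forwardCoeff, coeff_eq_gammaRatio_div, coeff_eq_gammaRatio_div, factorialRatio]
  push_cast
  have h1 : ((n.factorial : ℕ) : ℂ) ≠ 0 := by exact_mod_cast Nat.factorial_ne_zero n
  have h2 : (((n + j).factorial : ℕ) : ℂ) ≠ 0 := by exact_mod_cast Nat.factorial_ne_zero (n + j)
  field_simp

/-- On the scale `j ~ t √n` the Gamma ratios contribute only `(1 + j/n)^{α-β}`, which tends to `1`;
the factorials supply the Gaussian. -/
lemma tendsto_forwardCoeff (α β : ℂ) (hk : Tendsto k l atTop) {j : ι → ℕ} {t : ℝ}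
    (hj : Tendsto (fun i => (j i : ℝ) / Real.sqrt (k i)) l (𝓝 t)) :
    Tendsto (fun i => forwardCoeff α β (k i) (j i)) l (𝓝 (Complex.exp (-(t ^ 2 / 2)))) := by
  have h0 := tendsto_div_of_tendsto_div_sqrt hk hj
  have hpos := hk.eventually (eventually_gt_atTop 0)
  have h1 : Tendsto (fun i => k i + j i) l atTop :=
    tendsto_atTop_mono (fun i => Nat.le_add_right _ _) hk
  have h2 : Tendsto (fun i => ((1 + (j i : ℝ) / k i : ℝ) : ℂ) ^ (α - β)) l (𝓝 1) := by
    have h3 := (Complex.continuous_ofReal.tendsto _).comp (h0.const_add 1)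
    have h4 := h3.cpow (tendsto_const_nhds (x := α - β)) (by simp)
    simpa [Function.comp_def] using h4
  have h3 := (((tendsto_gammaRatio α β).comp h1).div ((tendsto_gammaRatio α β).comp hk)
    one_ne_zero).mul h2
  have h4 := h3.mul ((Complex.continuous_ofReal.tendsto _).comp (tendsto_factorialRatio hk hj))
  rw [div_one, one_mul, one_mul] at h4
  push_cast at h4
  refine h4.congr' ?_
  filter_upwards [hpos] with i hi
  have hn0 : (0 : ℝ) < k i := by exact_mod_cast hi
  have hn' : (k i : ℂ) ≠ 0 := by exact_mod_cast hi.ne'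
  have h5 : ((k i + j i : ℕ) : ℂ) ^ (α - β)
      = (k i : ℂ) ^ (α - β) * ((1 + (j i : ℝ) / k i : ℝ) : ℂ) ^ (α - β) := by
    rw [← Complex.ofReal_natCast (k i), ← Complex.mul_cpow_ofReal_nonneg hn0.le (by positivity)]
    congr 1
    push_cast
    field_simp
  have h6 : (k i : ℂ) ^ (α - β) ≠ 0 := by simp [Complex.cpow_eq_zero_iff, hn']
  have h7 : ((k i + j i : ℕ) : ℂ) ^ (α - β) ≠ 0 := by
    have : ((k i + j i : ℕ) : ℂ) ≠ 0 := by exact_mod_cast (by omega : k i + j i ≠ 0)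
    rw [Ne, Complex.cpow_eq_zero_iff]
    tauto
  rw [forwardCoeff_eq]
  simp only [Pi.div_apply, Function.comp_apply]
  have h8 : ((1 + (j i : ℝ) / k i : ℝ) : ℂ) ^ (α - β)
      = ((k i + j i : ℕ) : ℂ) ^ (α - β) / (k i : ℂ) ^ (α - β) := by
    rw [h5, mul_div_cancel_left₀ _ h6]
  push_cast at h8 h7 ⊢
  rw [h8]
  generalize (k i : ℂ) ^ (α - β) = p at *
  generalize ((k i : ℂ) + (j i : ℂ)) ^ (α - β) = q at *
  field_simp

end

/-! ### Limits near the critical point -/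

section

variable {ι : Type*} {l : Filter ι} {k : ι → ℕ}

lemma tendsto_sqrt_mul_div_sqrt (hk : Tendsto k l atTop) {w : ι → ℂ} {w₀ : ℂ}
    (hw : Tendsto w l (𝓝 w₀)) :
    Tendsto (fun i => (Real.sqrt (k i) : ℂ) * (w i / (Real.sqrt (k i) : ℂ))) l (𝓝 w₀) := by
  refine hw.congr' ?_
  filter_upwards [hk.eventually (eventually_gt_atTop 0)] with i hi
  rw [mul_div_cancel₀ _ (ofReal_sqrt_ne_zero hi)]

/-- For shifts of order `n^{-1/2}` the quadratic Taylor term survives and the cubic remainder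
vanishes. -/
lemma tendsto_mul_log_one_add_sub_sq {δ : ι → ℂ} (hk : Tendsto k l atTop) {w₀ : ℂ}
    (hδ : Tendsto (fun i => (Real.sqrt (k i) : ℂ) * δ i) l (𝓝 w₀)) :
    Tendsto (fun i => (k i : ℂ) * (Complex.log (1 + δ i) - δ i)) l (𝓝 (-(w₀ ^ 2 / 2))) := by
  have h0 := tendsto_zero_of_sqrt_mul hk hδ
  have h1 : Tendsto (fun i => (k i : ℂ) * (Complex.log (1 + δ i) - (δ i - δ i ^ 2 / 2))) l
      (𝓝 0) := by
    rw [tendsto_zero_iff_norm_tendsto_zero]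
    have h2 := (hδ.norm.pow 2).mul h0.norm
    rw [norm_zero, mul_zero] at h2
    refine squeeze_zero' (Eventually.of_forall fun i => norm_nonneg _) ?_ h2
    filter_upwards [h0.norm.eventually_le_const (show ‖(0 : ℂ)‖ < 1 / 2 by simp)] with i hi
    have h3 := Complex.norm_log_sub_logTaylor_le 2 (z := δ i) (by linarith)
    have h4 : (1 - ‖δ i‖)⁻¹ ≤ 2 := by
      rw [inv_le_comm₀ (by linarith) two_pos]
      linarith
    have h5 : Complex.logTaylor (2 + 1) (δ i) = δ i - δ i ^ 2 / 2 := by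
      simp [Complex.logTaylor, Finset.sum_range_succ]
      ring
    rw [h5] at h3
    rw [norm_mul, norm_mul, mul_pow, Complex.norm_natCast, Complex.norm_real,
      Real.norm_of_nonneg (Real.sqrt_nonneg _), Real.sq_sqrt (Nat.cast_nonneg _), mul_assoc]
    gcongr
    refine h3.trans ?_
    have h6 : 0 ≤ ‖δ i‖ ^ 3 := by positivity
    have := mul_le_mul_of_nonneg_left h4 h6
    norm_num
    rw [div_le_iff₀ (by norm_num)]
    nlinarith
  have h2 := h1.sub ((hδ.pow 2).div_const 2)
  rw [zero_sub] at h2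
  refine h2.congr fun i => ?_
  rw [mul_pow, sq (Real.sqrt (k i) : ℂ), ofReal_sqrt_mul_self]
  ring

lemma tendsto_sqrt_mul_log {δ : ι → ℂ} (hk : Tendsto k l atTop) {w₀ : ℂ}
    (hδ : Tendsto (fun i => (Real.sqrt (k i) : ℂ) * δ i) l (𝓝 w₀)) :
    Tendsto (fun i => (Real.sqrt (k i) : ℂ) * Complex.log (1 + δ i)) l (𝓝 w₀) := by
  have h := ((tendsto_ofReal_inv_sqrt.comp hk).mul (tendsto_mul_log_one_add_sub_sq hk hδ)).add hδ
  rw [zero_mul, zero_add] at h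
  refine h.congr' ?_
  filter_upwards [hk.eventually (eventually_gt_atTop 0)] with i hi
  have h1 := ofReal_sqrt_ne_zero hi
  rw [Function.comp_apply]
  rw [← ofReal_sqrt_mul_self (k i)]
  field_simp
  ring

lemma eventually_one_add_ne_zero {δ : ι → ℂ} (h : Tendsto δ l (𝓝 0)) :
    ∀ᶠ i in l, 1 + δ i ≠ 0 := by
  have h1 := h.const_add 1
  rw [add_zero] at h1
  exact h1.eventually_ne one_ne_zero

lemma tendsto_pow_critical {δ : ι → ℂ} (hk : Tendsto k l atTop) {w₀ : ℂ}
    (hδ : Tendsto (fun i => (Real.sqrt (k i) : ℂ) * δ i) l (𝓝 w₀)) :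
    Tendsto (fun i => ((1 + δ i) * Complex.exp (1 - (1 + δ i))) ^ k i) l
      (𝓝 (Complex.exp (-(w₀ ^ 2 / 2)))) := by
  refine ((Complex.continuous_exp.tendsto _).comp
    (tendsto_mul_log_one_add_sub_sq hk hδ)).congr' ?_
  filter_upwards [eventually_one_add_ne_zero (tendsto_zero_of_sqrt_mul hk hδ)] with i hi
  rw [Function.comp_apply, Complex.exp_nat_mul, sub_eq_add_neg, Complex.exp_add,
    Complex.exp_log hi]
  ring_nf

lemma tendsto_floor_mul_sqrt_div (hk : Tendsto k l atTop) {t : ℝ} (ht : 0 ≤ t) :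
    Tendsto (fun i => (⌊t * Real.sqrt (k i)⌋₊ : ℝ) / Real.sqrt (k i)) l (𝓝 t) :=
  ((tendsto_nat_floor_mul_div_atTop ht).comp tendsto_sqrt_natCast_atTop).comp hk

lemma one_add_pow_eq_exp {z : ℂ} (hz : 1 + z ≠ 0) {n : ℕ} (hn : 0 < n) (j : ℕ) :
    (1 + z) ^ j
      = Complex.exp (((j : ℝ) / Real.sqrt n : ℝ) * ((Real.sqrt n : ℂ) * Complex.log (1 + z))) := by
  have h1 := ofReal_sqrt_ne_zero hn
  push_cast
  rw [show ((j : ℂ) / (Real.sqrt n : ℂ)) * ((Real.sqrt n : ℂ) * Complex.log (1 + z))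
    = j * Complex.log (1 + z) by field_simp, Complex.exp_nat_mul, Complex.exp_log hz]

/-- This is where `Re w < 0` enters: it supplies the decay dominating the Riemann sum. Half of the
rate is given up to allow for the varying shift. -/
lemma eventually_norm_one_add_pow_le {δ : ι → ℂ} (hk : Tendsto k l atTop) {w₀ : ℂ}
    (hw₀ : w₀.re < 0) (hδ : Tendsto (fun i => (Real.sqrt (k i) : ℂ) * δ i) l (𝓝 w₀)) :
    ∀ᶠ i in l, ∀ j : ℕ, ‖(1 + δ i) ^ j‖ ≤ Real.exp (w₀.re / 2 * (j / Real.sqrt (k i))) := by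
  have h1 := (Complex.continuous_re.tendsto _).comp (tendsto_sqrt_mul_log hk hδ)
  filter_upwards [h1.eventually_le_const (show w₀.re < w₀.re / 2 by linarith),
    hk.eventually (eventually_gt_atTop 0),
    eventually_one_add_ne_zero (tendsto_zero_of_sqrt_mul hk hδ)] with i h2 hi h3 j
  rw [one_add_pow_eq_exp h3 hi, Complex.norm_exp, Complex.re_ofReal_mul, mul_comm]
  gcongr
  exact h2

lemma tendsto_critical_sum {α : ℂ} (hα : ∀ m : ℕ, α ≠ -(m : ℂ)) (β : ℂ)
    [l.IsCountablyGenerated] (hk : Tendsto k l atTop) {δ : ι → ℂ} {w₀ : ℂ} (hw₀ : w₀.re < 0)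
    (hδ : Tendsto (fun i => (Real.sqrt (k i) : ℂ) * δ i) l (𝓝 w₀)) :
    Tendsto (fun i => (∑' j, forwardCoeff α β (k i) j * (1 + δ i) ^ j) / (Real.sqrt (k i) : ℂ)) l
      (𝓝 (∫ t in Set.Ioi (0 : ℝ), Complex.exp (w₀ * t - t ^ 2 / 2))) := by
  obtain ⟨B, D, hBD⟩ := exists_slowRecurrence_forward hα β
  have hpos := hk.eventually (eventually_gt_atTop 0)
  have hδ0 := tendsto_zero_of_sqrt_mul hk hδ
  have hpow := eventually_norm_one_add_pow_le hk hw₀ hδ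
  set c : ℝ := -(w₀.re / 2) with hc
  have hc0 : 0 < c := by
    rw [hc]
    linarith
  have h := MeasureTheory.tendsto_integral_filter_of_dominated_convergence
    (μ := MeasureTheory.volume.restrict (Set.Ioi (0 : ℝ))) (l := l)
    (F := fun (i : ι) (t : ℝ) => forwardCoeff α β (k i) ⌊t * Real.sqrt (k i)⌋₊
      * (1 + δ i) ^ ⌊t * Real.sqrt (k i)⌋₊)
    (f := fun t : ℝ => Complex.exp (-(t ^ 2 / 2)) * Complex.exp (t * w₀))
    -- Rounding `t √n` down lowers `j/√n` by at most `1`, which costs the factor `e^c`.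
    (fun t => D * Real.exp c * Real.exp (-c * t))
    (Eventually.of_forall fun i => ((measurable_from_nat (f := fun j =>
      forwardCoeff α β (k i) j * (1 + δ i) ^ j)).comp
        (Nat.measurable_floor.comp (measurable_id.mul_const _))).aestronglyMeasurable)
    ?_ ((exp_neg_integrableOn_Ioi 0 hc0).const_mul _) ?_
  · have h2 : (fun t : ℝ => Complex.exp (w₀ * t - t ^ 2 / 2))
        = fun t : ℝ => Complex.exp (-(t ^ 2 / 2)) * Complex.exp (t * w₀) := by
      ext t
      rw [← Complex.exp_add]
      ring_nf
    rw [h2]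
    refine h.congr' ?_
    filter_upwards [hpos, hpow] with i hi h1
    have hn0 : (0 : ℝ) < k i := by exact_mod_cast hi
    have h3 : ‖1 + δ i‖ ≤ 1 := by
      have h4 := h1 1
      rw [pow_one] at h4
      refine h4.trans (Real.exp_le_one_iff.2 ?_)
      have : 0 ≤ ((1 : ℕ) : ℝ) / Real.sqrt (k i) := by positivity
      nlinarith
    exact integral_floor_mul_eq_tsum_div
      (summable_mul_pow_of_norm_le_one (summable_forwardCoeff α β (k i)) h3)
      (Real.sqrt_pos.2 hn0)
  · filter_upwards [hpos, hpow, hk.eventually hBD] with i hi h1 h2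
    filter_upwards [MeasureTheory.ae_restrict_mem measurableSet_Ioi] with t ht
    have ht' : (0 : ℝ) < t := ht
    have hn1 : (1 : ℝ) ≤ k i := h2.one_le
    have hs : 1 ≤ Real.sqrt (k i) := Real.one_le_sqrt.2 hn1
    have hD : 0 ≤ D := by
      have := (norm_nonneg _).trans (h2.decay 0)
      simpa using this
    set j := ⌊t * Real.sqrt (k i)⌋₊ with hj
    have h3 : t - 1 ≤ j / Real.sqrt (k i) := by
      rw [le_div_iff₀ (by linarith)]
      have := Nat.lt_floor_add_one (t * Real.sqrt (k i))
      nlinarith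
    have h4 : ‖forwardCoeff α β (k i) j‖ ≤ D := by
      refine (h2.decay j).trans (mul_le_of_le_one_right hD (Real.exp_le_one_iff.2 ?_))
      have : 0 ≤ (j : ℝ) ^ 2 / (4 * (k i + j)) := by positivity
      linarith
    rw [norm_mul]
    calc _ ≤ D * Real.exp (c + -c * t) := by
          refine mul_le_mul h4 ((h1 j).trans (Real.exp_le_exp.2 ?_)) (norm_nonneg _) hD
          rw [show w₀.re / 2 = -c by rw [hc]; ring]
          nlinarith
      _ = _ := by rw [Real.exp_add, mul_assoc]
  · filter_upwards [MeasureTheory.ae_restrict_mem measurableSet_Ioi] with t ht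
    have ht' : (0 : ℝ) < t := ht
    have hfl := tendsto_floor_mul_sqrt_div hk ht'.le
    refine (tendsto_forwardCoeff α β hk hfl).mul ?_
    refine ((Complex.continuous_exp.tendsto _).comp
      (((Complex.continuous_ofReal.tendsto _).comp hfl).mul
        (tendsto_sqrt_mul_log hk hδ))).congr' ?_
    filter_upwards [hpos, eventually_one_add_ne_zero hδ0] with i hi h3
    rw [one_add_pow_eq_exp h3 hi]
    rfl

/-- Reflecting `t` joins the two rays into one horizontal line, over which the Gaussian integrates
to `√π` for every `v`. -/
lemma erfc_add_erfc_neg (v : ℂ) : erfc v + erfc (-v) = 2 := by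
  have hint : MeasureTheory.Integrable (fun t : ℝ => Complex.exp (-(v + t) ^ 2)) := by
    refine (integrable_cexp_quadratic (b := 1) (by simp) (-2 * v) (-v ^ 2)).congr
      (Eventually.of_forall fun t => ?_)
    simp only
    ring_nf
  have h1 : ∫ t in Set.Ioi (0 : ℝ), Complex.exp (-(-v + t) ^ 2)
      = ∫ t in Set.Iic (0 : ℝ), Complex.exp (-(v + t) ^ 2) := by
    have := integral_comp_neg_Ioi 0 (fun t : ℝ => Complex.exp (-(v + t) ^ 2))
    rw [neg_zero] at this
    rw [← this]
    refine MeasureTheory.integral_congr_ae (Eventually.of_forall fun t => ?_)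
    simp only
    push_cast
    ring_nf
  have h2 : ∫ t : ℝ, Complex.exp (-(v + t) ^ 2) = (Real.sqrt Real.pi : ℂ) := by
    have h3 := integral_cexp_quadratic (b := -1) (by simp) (-2 * v) (-v ^ 2)
    rw [show -v ^ 2 - (-2 * v) ^ 2 / (4 * -1) = 0 by ring, Complex.exp_zero, mul_one, neg_neg,
      div_one] at h3
    rw [Real.sqrt_eq_rpow, Complex.ofReal_cpow Real.pi_pos.le]
    push_cast
    rw [← h3]
    refine MeasureTheory.integral_congr_ae (Eventually.of_forall fun t => ?_)
    simp only
    ring_nf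
  have h3 : (Real.sqrt Real.pi : ℂ) ≠ 0 := by
    exact_mod_cast (Real.sqrt_pos.2 Real.pi_pos).ne'
  rw [erfc, erfc, ← mul_add, h1, add_comm, intervalIntegral.integral_Iic_add_Ioi
    hint.integrableOn hint.integrableOn, h2, div_mul_cancel₀ _ h3]

/-- Substitute `√2 t` for `t` and complete the square. -/
lemma integral_eq_erfc (w : ℂ) :
    (Real.sqrt (2 * Real.pi) : ℂ)⁻¹ * (Complex.exp (-(w ^ 2 / 2))
      * ∫ t in Set.Ioi (0 : ℝ), Complex.exp (w * t - t ^ 2 / 2))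
      = 1 / 2 * erfc (-(w / (Real.sqrt 2 : ℂ))) := by
  have h2 : (0 : ℝ) < Real.sqrt 2 := Real.sqrt_pos.2 two_pos
  have h2' : (Real.sqrt 2 : ℂ) ≠ 0 := by exact_mod_cast h2.ne'
  have h3 : (Real.sqrt Real.pi : ℂ) ≠ 0 := by
    exact_mod_cast (Real.sqrt_pos.2 Real.pi_pos).ne'
  have h4 : (Real.sqrt 2 : ℂ) ^ 2 = 2 := by
    rw [← Complex.ofReal_pow, Real.sq_sqrt zero_le_two]
    norm_num
  have h1 := MeasureTheory.integral_comp_mul_left_Ioi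
    (fun t : ℝ => Complex.exp (w * t - t ^ 2 / 2)) 0 h2
  rw [mul_zero, Complex.real_smul, Complex.ofReal_inv, eq_inv_mul_iff_mul_eq₀ h2'] at h1
  rw [← h1, Real.sqrt_mul zero_le_two, Complex.ofReal_mul, erfc, mul_left_comm (Complex.exp _),
    ← MeasureTheory.integral_const_mul]
  have h5 : ∀ t : ℝ, Complex.exp (-(w ^ 2 / 2)) * Complex.exp (w * ((Real.sqrt 2 * t : ℝ) : ℂ)
      - ((Real.sqrt 2 * t : ℝ) : ℂ) ^ 2 / 2)
      = Complex.exp (-(-(w / (Real.sqrt 2 : ℂ)) + t) ^ 2) := by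
    intro t
    rw [← Complex.exp_add]
    congr 1
    push_cast
    rw [mul_pow, h4, show ∀ a : ℂ, -(-a + t) ^ 2 = -(a ^ 2 - 2 * t * a + t ^ 2) from
      fun a => by ring, div_pow, h4]
    have : w * (Real.sqrt 2 * t) = 2 * t * (w / Real.sqrt 2) := by
      field_simp
      rw [h4]
      ring
    rw [this]
    ring
  simp only [h5]
  field_simp

/-- The limit on the scale `n ^ (-1/2)` at the critical point `1`. -/
theorem limit_near_one {α : ℂ} (hα : ∀ m : ℕ, α ≠ -(m : ℂ)) (β : ℂ) {K : Set ℂ}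
    (hK : IsCompact K) (hKre : K ⊆ {w : ℂ | w.re < 0}) :
    (∀ᶠ n : ℕ in atTop, ∀ w ∈ K, M α β ((n : ℂ) + w * (Real.sqrt n : ℂ)) ≠ 0) ∧
      TendstoUniformlyOn
        (fun (n : ℕ) (w : ℂ) =>
          partialSum α β (n - 1) ((n : ℂ) + w * (Real.sqrt n : ℂ))
            / M α β ((n : ℂ) + w * (Real.sqrt n : ℂ)))
        (fun w => 1 / 2 * erfc (w / (Real.sqrt 2 : ℂ))) atTop K := by
  have hk : ∀ w₀ : ℂ, Tendsto (Prod.fst : ℕ × ℂ → ℕ) (atTop ×ˢ 𝓝[K] w₀) atTop := fun w₀ =>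
    tendsto_fst
  have hδ : ∀ w₀ : ℂ, Tendsto (fun p : ℕ × ℂ => (Real.sqrt p.1 : ℂ) * (p.2 / (Real.sqrt p.1 : ℂ)))
      (atTop ×ˢ 𝓝[K] w₀) (𝓝 w₀) := fun w₀ =>
    tendsto_sqrt_mul_div_sqrt (hk w₀) (tendsto_snd.mono_right nhdsWithin_le_nhds)
  have hζ : ∀ w₀ : ℂ, Tendsto (fun p : ℕ × ℂ => 1 + p.2 / (Real.sqrt p.1 : ℂ))
      (atTop ×ˢ 𝓝[K] w₀) (𝓝 1) := fun w₀ => by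
    have := (tendsto_zero_of_sqrt_mul (hk w₀) (hδ w₀)).const_add 1
    rwa [add_zero] at this
  have hpt : ∀ w₀ : ℂ, ∀ᶠ p : ℕ × ℂ in atTop ×ˢ 𝓝[K] w₀,
      (p.1 : ℂ) + p.2 * (Real.sqrt p.1 : ℂ) = p.1 * (1 + p.2 / (Real.sqrt p.1 : ℂ)) := fun w₀ => by
    filter_upwards [(hk w₀).eventually (eventually_gt_atTop 0)] with p hp
    have h1 := ofReal_sqrt_ne_zero hp
    have h2 := ofReal_sqrt_mul_self p.1
    field_simp
    linear_combination p.2 * h2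
  constructor
  · refine eventually_forall_of_forall_eventually hK fun w₀ _ => ?_
    filter_upwards [eventually_M_ne_zero hα β (hk w₀) (hζ w₀) (by simp), hpt w₀] with p h1 h2
    rwa [h2]
  · refine tendstoUniformlyOn_of_forall_tendsto hK fun w₀ hw₀ => ?_
    have h1 := (tendsto_pow_critical (hk w₀) (hδ w₀)).mul
      (tendsto_critical_sum hα β (hk w₀) (hKre hw₀) (hδ w₀))
    have h2 := tendsto_partialSum_div hα β (hk w₀) (hζ w₀) (by simp)
      (h1.congr fun p => by rw [mul_div_assoc', mul_div_right_comm])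
    have h3 : 1 - (Real.sqrt (2 * Real.pi) : ℂ)⁻¹ * (Complex.exp (-(w₀ ^ 2 / 2))
        * ∫ t in Set.Ioi (0 : ℝ), Complex.exp (w₀ * t - t ^ 2 / 2)) / 1 ^ (α - β)
        = 1 / 2 * erfc (w₀ / (Real.sqrt 2 : ℂ)) := by
      rw [Complex.one_cpow, div_one, integral_eq_erfc]
      linear_combination -(1 / 2) * erfc_add_erfc_neg (w₀ / (Real.sqrt 2 : ℂ))
    rw [h3] at h2
    refine h2.congr' ?_
    filter_upwards [hpt w₀] with p hp
    rw [hp]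

end

/-! ### Limit points of the zeros -/

/-- Divided by its leading term, the polynomial tends to `1 / (1 - 1/z₀)`, which is nonzero.
Restricting the filter to `‖z‖ ≥ 1` also covers centres on the unit circle. -/
lemma eventually_ne_zero_of_one_le_norm {α : ℂ} (hα : ∀ m : ℕ, α ≠ -(m : ℂ)) (β : ℂ) {z₀ : ℂ}
    (h0 : z₀ ≠ 0) (h1 : z₀ ≠ 1) :
    ∀ᶠ p : ℕ × ℂ in atTop ×ˢ 𝓝 z₀, 1 ≤ ‖p.2‖ → gammaPartialSum α β p.1 (p.1 * p.2) ≠ 0 := by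
  set l : Filter (ℕ × ℂ) := (atTop ×ˢ 𝓝 z₀) ⊓ 𝓟 {p | 1 ≤ ‖p.2‖} with hl
  suffices h : ∀ᶠ p in l, gammaPartialSum α β p.1 (p.1 * p.2) ≠ 0 from eventually_inf_principal.1 h
  have hk : Tendsto Prod.fst l atTop := tendsto_fst.mono_left inf_le_left
  have hζ : Tendsto Prod.snd l (𝓝 z₀) := tendsto_snd.mono_left inf_le_left
  have hn : ∀ᶠ p in l, ‖(p.2)⁻¹‖ ≤ 1 :=
    eventually_inf_principal.2 (Eventually.of_forall fun p h => by
      rw [norm_inv]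
      exact inv_le_one_of_one_le₀ h)
  obtain ⟨B, D, hBD⟩ := exists_slowRecurrence_backward hα β
  have hne : z₀⁻¹ ≠ 1 := fun h => h1 (inv_eq_one.1 h)
  have hsum := tendsto_tsum_of_slowRecurrence hBD
    (Eventually.of_forall (summable_backwardCoeff α β)) hk (hζ.inv₀ h0) hn hne
  filter_upwards [hsum.eventually_ne (inv_ne_zero (sub_ne_zero.2 hne.symm)),
    hk.eventually (eventually_gt_atTop 0), hζ.eventually_ne h0,
    hk.eventually ((tendsto_sub_atTop_nat 1).eventually (eventually_coeff_ne_zero hα β))]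
    with p hp hp0 hpz hc
  have hn' : (p.1 : ℂ) ≠ 0 := by exact_mod_cast hp0.ne'
  rw [gammaPartialSum, partialSum_eq_tsum_backwardCoeff hp0 hc hpz]
  exact mul_ne_zero (mul_ne_zero hc (pow_ne_zero _ (mul_ne_zero hn' hpz))) hp

lemma tendsto_pow_div_sqrt_of_norm_lt_one {ι : Type*} {l : Filter ι} {k : ι → ℕ}
    (hk : Tendsto k l atTop) {q : ι → ℂ} {q₀ : ℂ} (hq : Tendsto q l (𝓝 q₀)) (h : ‖q₀‖ < 1) :
    Tendsto (fun i => q i ^ k i / (Real.sqrt (k i) : ℂ)) l (𝓝 0) := by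
  obtain ⟨ρ, h1, h2⟩ := exists_between h
  have h0 : 0 ≤ ρ := (norm_nonneg _).trans h1.le
  rw [tendsto_zero_iff_norm_tendsto_zero]
  refine squeeze_zero' (Eventually.of_forall fun i => norm_nonneg _) ?_
    ((tendsto_pow_atTop_nhds_zero_of_lt_one h0 h2).comp hk)
  filter_upwards [hq.norm.eventually_le_const h1, hk.eventually (eventually_ge_atTop 1)] with i hi h3
  have h4 : 1 ≤ Real.sqrt (k i) := Real.one_le_sqrt.2 (by exact_mod_cast h3)
  rw [norm_div, norm_pow, Complex.norm_real, Real.norm_of_nonneg (Real.sqrt_nonneg _)]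
  exact (div_le_self (by positivity) h4).trans (pow_le_pow_left₀ (norm_nonneg _) hi _)

lemma tendsto_sqrt_div_pow_of_one_lt_norm {ι : Type*} {l : Filter ι} {k : ι → ℕ}
    (hk : Tendsto k l atTop) {q : ι → ℂ} {q₀ : ℂ} (hq : Tendsto q l (𝓝 q₀)) (h : 1 < ‖q₀‖) :
    Tendsto (fun i => (q i ^ k i / (Real.sqrt (k i) : ℂ))⁻¹) l (𝓝 0) := by
  obtain ⟨ρ, h1, h2⟩ := exists_between h
  have h0 : 0 < ρ := by linarith
  rw [tendsto_zero_iff_norm_tendsto_zero]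
  refine squeeze_zero' (Eventually.of_forall fun i => norm_nonneg _) ?_
    ((tendsto_pow_const_div_const_pow_of_one_lt 1 h1).comp hk)
  filter_upwards [hq.norm.eventually_const_le h2, hk.eventually (eventually_ge_atTop 1)] with i hi h3
  have h4 : (1 : ℝ) ≤ k i := by exact_mod_cast h3
  have h5 : Real.sqrt (k i) ≤ k i := by
    rw [Real.sqrt_le_left (by linarith)]
    nlinarith
  rw [inv_div, norm_div, norm_pow, Complex.norm_real, Real.norm_of_nonneg (Real.sqrt_nonneg _),
    Function.comp_apply, pow_one]
  gcongr

/-- Off the curve one side dominates. If `|z₀ e^{1-z₀}| < 1` the tail is negligible against the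
series; if it exceeds `1`, the partial sum divided by the size of the tail has the nonzero limit `-1
/ (√(2π) (1 - z₀))`. -/
lemma eventually_ne_zero_of_norm_le_one {α : ℂ} (hα : ∀ m : ℕ, α ≠ -(m : ℂ)) (β : ℂ) {z₀ : ℂ}
    (hre : 0 < z₀.re) (h1 : z₀ ≠ 1) (hz : ‖z₀ * Complex.exp (1 - z₀)‖ ≠ 1) :
    ∀ᶠ p : ℕ × ℂ in atTop ×ˢ 𝓝 z₀, ‖p.2‖ ≤ 1 → gammaPartialSum α β p.1 (p.1 * p.2) ≠ 0 := by
  have hz0 : z₀ ≠ 0 := by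
    rintro rfl
    simp at hre
  set l : Filter (ℕ × ℂ) := (atTop ×ˢ 𝓝 z₀) ⊓ 𝓟 {p | ‖p.2‖ ≤ 1} with hl
  suffices h : ∀ᶠ p in l, gammaPartialSum α β p.1 (p.1 * p.2) ≠ 0 from eventually_inf_principal.1 h
  have hk : Tendsto Prod.fst l atTop := tendsto_fst.mono_left inf_le_left
  have hζ : Tendsto Prod.snd l (𝓝 z₀) := tendsto_snd.mono_left inf_le_left
  have hn : ∀ᶠ p in l, ‖p.2‖ ≤ 1 := eventually_inf_principal.2 (Eventually.of_forall fun p h => h)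
  have hsum := tendsto_forward_sum hα β hk hζ hn h1
  have hq : Tendsto (fun p : ℕ × ℂ => p.2 * Complex.exp (1 - p.2)) l
      (𝓝 (z₀ * Complex.exp (1 - z₀))) :=
    ((by fun_prop : Continuous fun z : ℂ => z * Complex.exp (1 - z)).tendsto z₀).comp hζ
  rcases lt_or_gt_of_ne hz with h | h
  · have hY := (tendsto_pow_div_sqrt_of_norm_lt_one hk hq h).mul hsum
    rw [zero_mul] at hY
    have h2 := tendsto_gammaPartialSum_scaled hα β hk hζ hre hY
    rw [mul_zero, sub_zero] at h2
    filter_upwards [h2.eventually_ne (cpow_ne_zero_of_re_pos hre (α - β))] with p hp h3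
    exact hp (by simp [h3])
  · have h2 := ((tendsto_sqrt_div_pow_of_one_lt_norm hk hq h).mul
      (tendsto_series_scaled hα β hk hζ hre)).sub (((tendsto_coeff_scaled α β).comp hk).mul hsum)
    rw [zero_mul, zero_sub] at h2
    have h3 : (Real.sqrt (2 * Real.pi) : ℂ)⁻¹ ≠ 0 := by
      have : (0 : ℝ) < Real.sqrt (2 * Real.pi) := Real.sqrt_pos.2 Real.two_pi_pos
      exact inv_ne_zero (by exact_mod_cast this.ne')
    have h4 := h2.eventually_ne (neg_ne_zero.2 (mul_ne_zero h3
      (inv_ne_zero (sub_ne_zero.2 h1.symm))))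
    filter_upwards [h4, hk.eventually (eventually_gt_atTop 0), hζ.eventually_ne hz0,
      hk.eventually (eventually_coeff_ne_zero hα β)] with p hp hp0 hpz hc h5
    refine hp ?_
    have h6 := series_sub_partialSum_eq hp0 hc p.2
    rw [show ∑ k ∈ Finset.range (p.1 - 1 + 1), coeff α β k * ((p.1 : ℂ) * p.2) ^ k = 0 from h5,
      sub_zero] at h6
    have h7 := coeff_mul_pow_div α β hp0 p.2
    have h8 : (p.2 * Complex.exp (1 - p.2)) ^ p.1 / (Real.sqrt p.1 : ℂ) ≠ 0 :=
      div_ne_zero (pow_ne_zero _ (mul_ne_zero hpz (Complex.exp_ne_zero _)))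
        (ofReal_sqrt_ne_zero hp0)
    rw [Function.comp_apply, sub_eq_zero, inv_mul_eq_iff_eq_mul₀ h8, ← mul_assoc,
      mul_comm (_ / (Real.sqrt p.1 : ℂ)), ← h7, h6]
    ring

lemma isLimitPointOfZeros_mem_szegoCurve {α : ℂ} (hα : ∀ m : ℕ, α ≠ -(m : ℂ)) (β : ℂ) {z₀ : ℂ}
    (hre : 0 < z₀.re)
    (h : IsLimitPointOfZeros (fun n z => partialSum α β (n - 1) ((n : ℂ) * z)) z₀) :
    z₀ ∈ szegoCurve := by
  by_contra hS
  have hz0 : z₀ ≠ 0 := by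
    rintro rfl
    simp at hre
  have h1 : z₀ ≠ 1 := by
    rintro rfl
    exact hS (by simp [szegoCurve])
  have key : ∀ᶠ p : ℕ × ℂ in atTop ×ˢ 𝓝 z₀, gammaPartialSum α β p.1 (p.1 * p.2) ≠ 0 := by
    have hout := eventually_ne_zero_of_one_le_norm hα β hz0 h1
    rcases lt_or_ge 1 ‖z₀‖ with h2 | h2
    · filter_upwards [hout, ((continuous_norm.tendsto z₀).comp tendsto_snd).eventually_const_le h2]
        with p hp hp2 using hp hp2
    · filter_upwards [hout, eventually_ne_zero_of_norm_le_one hα β hre h1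
        fun h3 => hS ⟨h3, h2, hre⟩] with p hp hp2
      exact (le_total 1 ‖p.2‖).elim hp hp2
  obtain ⟨pa, hpa, pb, hpb, hab⟩ := eventually_prod_iff.1 key
  obtain ⟨ε, hε, hball⟩ := Metric.mem_nhds_iff.1 hpb
  obtain ⟨n, ⟨z, hz, hzero⟩, hn⟩ := ((h ε hε).and_eventually hpa).exists
  refine hab hn (hball hz) ?_
  simp only [partialSum_eq] at hzero
  exact (mul_eq_zero.1 hzero).resolve_left (one_div_ne_zero (Complex.Gamma_ne_zero hα))

/-- A form of Hurwitz's theorem: functions uniformly close on a disc to a function whose zero at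
the centre is isolated have zeros in the disc. -/
lemma eventually_exists_zero {H : ℕ → ℂ → ℂ} (hH : ∀ n, Differentiable ℂ (H n)) {G : ℂ → ℂ}
    {w₀ : ℂ} {r m : ℝ} (hr : 0 < r) (hm : 0 < m)
    (hlim : TendstoUniformlyOn H G atTop (Metric.closedBall w₀ r)) (h0 : G w₀ = 0)
    (hG : ∀ w ∈ Metric.sphere w₀ r, m ≤ ‖G w‖) :
    ∀ᶠ n in atTop, ∃ w ∈ Metric.closedBall w₀ r, H n w = 0 := by
  filter_upwards [Metric.tendstoUniformlyOn_iff.1 hlim (m / 8) (by positivity)] with n hn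
  have h1 : ‖H n w₀‖ < m / 8 := by
    have := hn w₀ (Metric.mem_closedBall_self hr.le)
    rwa [h0, dist_zero_left] at this
  have h2 : ∀ w ∈ Metric.sphere w₀ r, m / 2 ≤ ‖H n w - H n w₀‖ := by
    intro w hw
    have h3 := hn w (Metric.sphere_subset_closedBall hw)
    rw [dist_eq_norm] at h3
    have h4 : G w = (G w - H n w) + (H n w - H n w₀) + H n w₀ := by ring
    have h5 := hG w hw
    rw [h4] at h5
    have h6 := norm_add₃_le (a := G w - H n w) (b := H n w - H n w₀) (c := H n w₀)
    linarith
  -- A quantitative open mapping theorem: the image contains the ball of radius `m/4` about `H n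
  -- w₀`, hence `0`, since `‖H n w₀‖ < m/8`.
  have h3 := (hH n).diffContOnCl.ball_subset_image_closedBall hr h2 ?_
  · obtain ⟨w, hw, hw0⟩ := h3 (show (0 : ℂ) ∈ Metric.ball (H n w₀) (m / 2 / 2) by
      rw [Metric.mem_ball, dist_zero_left]
      linarith)
    exact ⟨w, hw, hw0⟩
  · intro hev
    have hev' : H n =ᶠ[𝓝 w₀] fun _ => H n w₀ := by
      filter_upwards [hev] with w hw
      exact not_not.1 hw
    have heq := AnalyticOnNhd.eq_of_eventuallyEq (fun w _ => (hH n).analyticAt w)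
      analyticOnNhd_const hev'
    have hs : w₀ + r ∈ Metric.sphere w₀ r := by
      simp [abs_of_pos hr]
    have h4 := h2 _ hs
    rw [congrFun heq (w₀ + r), sub_self, norm_zero] at h4
    linarith

/-- The Hurwitz argument is applied to the scaled numerator, which is entire in `w`, so zeros of `𝐌`
play no role. Its limit vanishes where `e^{-w} = C`, in particular at `w₀ = -log C`. -/
lemma isLimitPointOfZeros_of_ne_one {α : ℂ} (hα : ∀ m : ℕ, α ≠ -(m : ℂ)) (β : ℂ) {ξ : ℂ}
    (hξ : ξ ∈ szegoCurve) (hξ1 : ξ ≠ 1) :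
    IsLimitPointOfZeros (fun n z => partialSum α β (n - 1) ((n : ℂ) * z)) ξ := by
  intro ε hε
  refine Eventually.frequently ?_
  have hcp := cpow_ne_zero_of_re_pos hξ.2.2 (α - β)
  have hsub : 1 - ξ ≠ 0 := sub_ne_zero.2 hξ1.symm
  have hpi : (Real.sqrt (2 * Real.pi) : ℂ) ≠ 0 := by
    exact_mod_cast (Real.sqrt_pos.2 Real.two_pi_pos).ne'
  set C : ℂ := ξ ^ (α - β) * (1 - ξ) * (Real.sqrt (2 * Real.pi) : ℂ) with hC
  have hC0 : C ≠ 0 := mul_ne_zero (mul_ne_zero hcp hsub) hpi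
  set w₀ : ℂ := -Complex.log C with hw₀
  set G : ℂ → ℂ := fun w => ξ ^ (α - β)
    - (Real.sqrt (2 * Real.pi) : ℂ)⁻¹ * (Complex.exp (-w) * (1 - ξ)⁻¹) with hG
  have hGw : ∀ w, G w = -ξ ^ (α - β) * (Complex.exp (-(w - w₀)) - 1) := by
    intro w
    have h1 : Complex.exp (-(w - w₀)) = Complex.exp (-w) * C⁻¹ := by
      rw [hw₀, show -(w - -Complex.log C) = -w + -Complex.log C by ring, Complex.exp_add,
        Complex.exp_neg (Complex.log C), Complex.exp_log hC0]
    rw [h1, hG, hC]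
    field_simp
    ring
  have hlim : TendstoUniformlyOn (fun (n : ℕ) (w : ℂ) =>
      gammaPartialSum α β n (n * arcPoint ξ n w) * Complex.exp (-(n * arcPoint ξ n w))
        / (n : ℂ) ^ (α - β)) G atTop (Metric.closedBall w₀ (1 / 2)) := by
    refine tendstoUniformlyOn_of_forall_tendsto (isCompact_closedBall _ _) fun w _ => ?_
    have hw : Tendsto (Prod.snd : ℕ × ℂ → ℂ) (atTop ×ˢ 𝓝[Metric.closedBall w₀ (1 / 2)] w) (𝓝 w) :=
      tendsto_snd.mono_right nhdsWithin_le_nhds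
    have hk : Tendsto (Prod.fst : ℕ × ℂ → ℕ) (atTop ×ˢ 𝓝[Metric.closedBall w₀ (1 / 2)] w) atTop :=
      tendsto_fst
    exact tendsto_gammaPartialSum_scaled hα β hk (tendsto_arcPoint ξ hk hw) hξ.2.2
      (tendsto_arcPoint_main hα β hξ hξ1 hk hw)
  have hzeros := eventually_exists_zero (m := ‖ξ ^ (α - β)‖ / 4) (fun n => by
    unfold gammaPartialSum arcPoint
    fun_prop) one_half_pos (by positivity) hlim (by rw [hGw]; simp) (fun w hw => by
      have hu : ‖-(w - w₀)‖ = 1 / 2 := by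
        rw [norm_neg, ← dist_eq_norm]
        exact hw
      have h1 := Complex.norm_exp_sub_one_sub_id_le (x := -(w - w₀)) (by rw [hu]; norm_num)
      have h2 := norm_sub_norm_le (-(w - w₀))
        (-(Complex.exp (-(w - w₀)) - 1 - -(w - w₀)))
      rw [norm_neg (Complex.exp _ - 1 - _), hu, show -(w - w₀)
        - -(Complex.exp (-(w - w₀)) - 1 - -(w - w₀)) = Complex.exp (-(w - w₀)) - 1 by ring] at h2
      rw [hu] at h1
      rw [hGw, norm_mul, norm_neg]
      -- `|e^u - 1| ≥ |u| - |u|²` at `|u| = 1/2`.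
      have h3 : 1 / 4 ≤ ‖Complex.exp (-(w - w₀)) - 1‖ := by linarith
      nlinarith [norm_nonneg (ξ ^ (α - β))])
  have hnear : ∀ᶠ n : ℕ in atTop, ∀ w ∈ Metric.closedBall w₀ (1 / 2),
      arcPoint ξ n w ∈ Metric.ball ξ ε :=
    eventually_forall_of_forall_eventually (isCompact_closedBall _ _) fun w _ =>
      (tendsto_arcPoint ξ tendsto_fst (tendsto_snd.mono_right nhdsWithin_le_nhds)).eventually
        (Metric.ball_mem_nhds ξ hε)
  filter_upwards [hzeros, hnear, eventually_gt_atTop 0] with n ⟨w, hw, h0⟩ hn hpos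
  refine ⟨arcPoint ξ n w, hn w hw, ?_⟩
  have hn' : (n : ℂ) ≠ 0 := by exact_mod_cast hpos.ne'
  have h5 : (n : ℂ) ^ (α - β) ≠ 0 := by simp [Complex.cpow_eq_zero_iff, hn']
  have h6 := (div_eq_zero_iff.1 h0).resolve_right h5
  rw [partialSum_eq, (mul_eq_zero.1 h6).resolve_right (Complex.exp_ne_zero _), mul_zero]

/-- The curve equation reads `|z| = e^{Re z - 1}`, so the abscissa `x` determines the ordinate up to
sign, and `x ≤ e^{x-1}` makes it real. Let `x` increase to `1`. -/
lemma exists_mem_szegoCurve_near_one {ε : ℝ} (hε : 0 < ε) :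
    ∃ ξ ∈ szegoCurve, ξ ≠ 1 ∧ dist ξ 1 < ε := by
  set φ : ℝ → ℂ := fun x => ⟨x, Real.sqrt (Real.exp (x - 1) ^ 2 - x ^ 2)⟩ with hφ
  have hcont : Continuous φ := by
    have : φ = fun x : ℝ => (x : ℂ)
        + (Real.sqrt (Real.exp (x - 1) ^ 2 - x ^ 2) : ℂ) * Complex.I := by
      ext x
      exact Complex.mk_eq_add_mul_I _ _
    rw [this]
    fun_prop
  have h1 : φ 1 = 1 := by
    apply Complex.ext <;> simp [hφ]
  obtain ⟨δ, hδ, h⟩ := Metric.continuous_iff.1 hcont 1 ε hε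
  obtain ⟨x, hx1, hx2⟩ := exists_between (max_lt (show (0 : ℝ) < 1 by norm_num)
    (show 1 - δ < 1 by linarith))
  obtain ⟨hx0, hxδ⟩ := max_lt_iff.1 hx1
  have hn : ‖φ x‖ = Real.exp (x - 1) := by
    have hle : x ≤ Real.exp (x - 1) := by linarith [Real.add_one_le_exp (x - 1)]
    have h2 : 0 ≤ Real.exp (x - 1) ^ 2 - x ^ 2 := by nlinarith
    rw [Complex.norm_def, Complex.normSq_mk, Real.mul_self_sqrt h2,
      show x * x + (Real.exp (x - 1) ^ 2 - x ^ 2) = Real.exp (x - 1) ^ 2 by ring,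
      Real.sqrt_sq (Real.exp_pos _).le]
  refine ⟨φ x, ⟨?_, ?_, hx0⟩, fun h2 => ?_, ?_⟩
  · rw [norm_mul, hn, Complex.norm_exp, ← Real.exp_add, Real.exp_eq_one_iff]
    simp [hφ]
  · rw [hn, Real.exp_le_one_iff]
    linarith
  · have := congrArg Complex.re h2
    simp only [hφ, Complex.one_re] at this
    linarith
  · have h2 := h x (by
      rw [Real.dist_eq, abs_sub_lt_iff]
      constructor <;> linarith)
    rwa [h1] at h2

/-- The limit points of the zeros in the right half-plane form the Szegő curve. -/
theorem limitPoints_eq_szegoCurve {α : ℂ} (hα : ∀ m : ℕ, α ≠ -(m : ℂ)) (β : ℂ) :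
    {z : ℂ | 0 < z.re ∧ IsLimitPointOfZeros
        (fun n z => partialSum α β (n - 1) ((n : ℂ) * z)) z} = szegoCurve := by
  ext z
  constructor
  · rintro ⟨hre, h⟩
    exact isLimitPointOfZeros_mem_szegoCurve hα β hre h
  · intro hz
    refine ⟨hz.2.2, ?_⟩
    by_cases h1 : z = 1
    · subst h1
      intro ε hε
      obtain ⟨ξ, hξ, hξ1, hd⟩ := exists_mem_szegoCurve_near_one (half_pos hε)
      refine (isLimitPointOfZeros_of_ne_one hα β hξ hξ1 (ε / 2) (half_pos hε)).mono ?_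
      rintro n ⟨z, hz, h0⟩
      refine ⟨z, Metric.ball_subset_ball' ?_ hz, h0⟩
      linarith
    · exact isLimitPointOfZeros_of_ne_one hα β hz h1

end ConfluentSections

theorem mainTheorem12 (α β : ℂ) (hα : ∀ m : ℕ, α ≠ -(m : ℂ)) :
    {z : ℂ | 0 < z.re ∧ ConfluentSections.IsLimitPointOfZeros
        (fun n z => ConfluentSections.partialSum α β (n - 1) ((n : ℂ) * z)) z}
      = ConfluentSections.szegoCurve ∧
    (∀ ξ ∈ ConfluentSections.szegoCurve, ξ ≠ 1 → ∀ K : Set ℂ, IsCompact K →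
      (∀ᶠ n : ℕ in atTop, ∀ w ∈ K,
        ConfluentSections.M α β ((n : ℂ) * ConfluentSections.arcPoint ξ n w) ≠ 0) ∧
      TendstoUniformlyOn
        (fun (n : ℕ) (w : ℂ) =>
          ConfluentSections.partialSum α β (n - 1) ((n : ℂ) * ConfluentSections.arcPoint ξ n w)
            / ConfluentSections.M α β ((n : ℂ) * ConfluentSections.arcPoint ξ n w))
        (fun w => 1 - Complex.exp (-w)
          / (ξ ^ (α - β) * (1 - ξ) * (Real.sqrt (2 * Real.pi) : ℂ)))
        atTop K) ∧
    (∀ K : Set ℂ, IsCompact K → K ⊆ {w : ℂ | w.re < 0} →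
      (∀ᶠ n : ℕ in atTop, ∀ w ∈ K,
        ConfluentSections.M α β ((n : ℂ) + w * (Real.sqrt n : ℂ)) ≠ 0) ∧
      TendstoUniformlyOn
        (fun (n : ℕ) (w : ℂ) =>
          ConfluentSections.partialSum α β (n - 1) ((n : ℂ) + w * (Real.sqrt n : ℂ))
            / ConfluentSections.M α β ((n : ℂ) + w * (Real.sqrt n : ℂ)))
        (fun w => 1 / 2 * ConfluentSections.erfc (w / (Real.sqrt 2 : ℂ)))
        atTop K) := by
  exact ⟨ConfluentSections.limitPoints_eq_szegoCurve hα β,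
    fun ξ hξ hξ1 K hK => ConfluentSections.limit_near_arc hα β hξ hξ1 hK,
    fun K hK hKre => ConfluentSections.limit_near_one hα β hK hKre⟩
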